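/- Let $\mathbb{R}^+=[0,\infty)$ with Lebesgue measure. For $j\in\mathbb{Z}$ and $k\in\{0,1,2,\dots\}$ let $I^j_k=[k2^{-j},(k+1)2^{-j})$ be the dyadic intervals, let $h^j_k(x)=2^{j/2}h^0_0(2^jx-k)$ with $h^0_0=\chi_{[0,1/2)}-\chi_{[1/2,1)}$ be the Haar functions, let $\mathscr{H}=\{h^j_k\}$, and for $h=h^j_k$ write $I(h)=I^j_k$ and $j(h)=j$. For $x,y\in\mathbb{R}^+$ let $\delta(x,y)$ be the infimum of the lengths $|I|$ of the dyadic intervals $I$ that contain both $x$ and $y$. Let $K:\mathbb{R}^+\times\mathbb{R}^+\to[0,\infty)$ depend only on $\delta$ (that is, $\delta(x,y)=\delta(x',y')$ implies $K(x,y)=K(x',y')$) and satisfy $\int_{\mathbb{R}^+}K(x_0,y)\,dy=1$ for some $x_0\in\mathbb{R}^+$. Let $Tf(x)=\int_{\mathbb{R}^+}K(x,y)f(y)\,dy$. Let $k_j$ be the constant value of $K$ on $\{\delta=2^j\}$, let $\alpha_l=2^{-l}(k_{-l}-k_{-l+1})$ and $\Lambda_j=\sum_{l>j}\alpha_l$,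 and for $h\in\mathscr{H}$ let $\lambda(h)=\Lambda_{j(h)}$ (the eigenvalue of $T$ at $h$). Let $1<p<\infty$. Then for every real-valued $f\in L^p(\mathbb{R}^+)$ the integral defining $Tf(x)$ converges absolutely for almost every $x\in\mathbb{R}^+$ and $Tf\in L^p(\mathbb{R}^+)$, and there are constants $C_1,C_2\in(0,\infty)$, which do not depend on $f$, such that for every real-valued $f\in L^p(\mathbb{R}^+)$ $$C_1\|Tf\|_p\le\Bigl\|\Bigl(\sum_{h\in\mathscr{H}}\lambda(h)^2\,|\langle f,h\rangle|^2\,|I(h)|^{-1}\chi_{I(h)}\Bigr)^{1/2}\Bigr\|_p\le C_2\|Tf\|_p ,$$ where $\langle f,h\rangle=\int_{\mathbb{R}^+}f(x)h(x)\,dx$. -/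

import Mathlib

open MeasureTheory Set
open scoped ENNReal NNReal

namespace DyadicMarkov

noncomputable section

/-- Lebesgue measure on `ℝ⁺ = [0, ∞)`, as a measure on `ℝ`. -/
def posVolume : Measure ℝ := volume.restrict (Ici 0)

/-- The dyadic interval `I^j_k = [k 2^{-j}, (k+1) 2^{-j})`. -/
def dyadicInterval (j : ℤ) (k : ℕ) : Set ℝ :=
  Ico ((k : ℝ) * (2 : ℝ) ^ (-j)) (((k : ℝ) + 1) * (2 : ℝ) ^ (-j))

/-- The dyadic distance: the infimum of the lengths of the dyadic intervals containing both points.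
It is used for points of `ℝ⁺` only. -/
def dyadicDist (x y : ℝ) : ℝ :=
  sInf {r : ℝ | ∃ (j : ℤ) (k : ℕ), x ∈ dyadicInterval j k ∧ y ∈ dyadicInterval j k ∧
    r = volume.real (dyadicInterval j k)}

/-- The mother Haar function `χ_{[0,1/2)} - χ_{[1/2,1)}`. -/
def haarMother (x : ℝ) : ℝ :=
  (Ico (0 : ℝ) (1 / 2)).indicator 1 x - (Ico (1 / 2 : ℝ) 1).indicator 1 x

/-- The Haar function `h^j_k(x) = 2^{j/2} h^0_0(2^j x - k)`, supported in `dyadicInterval j k`. -/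
def haar (j : ℤ) (k : ℕ) (x : ℝ) : ℝ :=
  (2 : ℝ) ^ ((j : ℝ) / 2) * haarMother ((2 : ℝ) ^ j * x - k)

/-- The Haar coefficient `⟨f, h^j_k⟩`. -/
def haarCoeff (f : ℝ → ℝ) (j : ℤ) (k : ℕ) : ℝ := ∫ x, f x * haar j k x ∂posVolume

/-- The class `𝒦`: nonnegative kernels on `ℝ⁺ × ℝ⁺` that depend only on the dyadic distance and
have integral `1` in the second variable at some point. Only the values on `ℝ⁺ × ℝ⁺` matter. -/
structure IsDyadicMarkovKernel (K : ℝ → ℝ → ℝ) : Prop where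
  nonneg : ∀ x y : ℝ, 0 ≤ x → 0 ≤ y → 0 ≤ K x y
  depends_only : ∀ x y x' y' : ℝ, 0 ≤ x → 0 ≤ y → 0 ≤ x' → 0 ≤ y' →
    dyadicDist x y = dyadicDist x' y' → K x y = K x' y'
  exists_integral_eq_one : ∃ x₀ : ℝ, 0 ≤ x₀ ∧ ∫ y, K x₀ y ∂posVolume = 1

/-- The operator `Tf(x) = ∫_{ℝ⁺} K(x,y) f(y) dy`. -/
def kernelOp (K : ℝ → ℝ → ℝ) (f : ℝ → ℝ) (x : ℝ) : ℝ := ∫ y, K x y * f y ∂posVolume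

/-- The coefficient `k_j`: the constant value of `K` on the level set `{δ = 2^j}`, read off at the
point `(0, 2^{j-1})` of this level set (see `IsDyadicMarkovKernel.eq_levelCoeff`). -/
def levelCoeff (K : ℝ → ℝ → ℝ) (j : ℤ) : ℝ := K 0 ((2 : ℝ) ^ (j - 1))

/-- `α_l = 2^{-l} (k_{-l} - k_{-l+1})`. -/
def alphaCoeff (K : ℝ → ℝ → ℝ) (l : ℤ) : ℝ :=
  (2 : ℝ) ^ (-l) * (levelCoeff K (-l) - levelCoeff K (-l + 1))

/-- `Λ_j = ∑_{l > j} α_l`, the eigenvalue `λ(h)` of `T` at every Haar function `h = h^j_k` of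
level `j`. -/
def eigenvalue (K : ℝ → ℝ → ℝ) (j : ℤ) : ℝ := ∑' l : {l : ℤ // j < l}, alphaCoeff K l

/-- The square function
`(∑_h λ(h)² |⟨f,h⟩|² |I(h)|^{-1} χ_{I(h)}(x))^{1/2}`, with values in `[0, ∞]`. -/
def haarSquareFunction (K : ℝ → ℝ → ℝ) (f : ℝ → ℝ) (x : ℝ) : ℝ≥0∞ :=
  (∑' q : ℤ × ℕ, ENNReal.ofReal
    (eigenvalue K q.1 ^ 2 * |haarCoeff f q.1 q.2| ^ 2 *
      (volume.real (dyadicInterval q.1 q.2))⁻¹ *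
      (dyadicInterval q.1 q.2).indicator 1 x)) ^ (1 / 2 : ℝ)

theorem volume_real_dyadicInterval (j : ℤ) (k : ℕ) :
    volume.real (dyadicInterval j k) = (2 : ℝ) ^ (-j) := by
  have h : (0 : ℝ) < (2 : ℝ) ^ (-j) := by positivity
  rw [dyadicInterval, Real.volume_real_Ico_of_le (by nlinarith)]
  ring

theorem dyadicDist_zero_zpow (j : ℤ) : dyadicDist 0 ((2 : ℝ) ^ (j - 1)) = (2 : ℝ) ^ j := by
  apply IsLeast.csInf_eq
  constructor
  · refine ⟨-j, 0, ?_, ?_, ?_⟩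
    · simp [dyadicInterval]; positivity
    · simp only [dyadicInterval, Nat.cast_zero, zero_mul, zero_add, one_mul, neg_neg, mem_Ico]
      exact ⟨by positivity, zpow_lt_zpow_right₀ (by norm_num) (by omega)⟩
    · rw [volume_real_dyadicInterval, neg_neg]
  · rintro r ⟨i, k, h0, h1, rfl⟩
    rw [volume_real_dyadicInterval]
    have hp : (0 : ℝ) < (2 : ℝ) ^ (-i) := by positivity
    have hk : (k : ℝ) = 0 := by
      have h2 : (k : ℝ) * (2 : ℝ) ^ (-i) ≤ 0 := h0.1
      have h3 : (0 : ℝ) ≤ k := Nat.cast_nonneg k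
      nlinarith
    have h4 : (2 : ℝ) ^ (j - 1) < (2 : ℝ) ^ (-i) := by simpa [hk] using h1.2
    have h5 : j - 1 < -i := (zpow_lt_zpow_iff_right₀ (by norm_num)).1 h4
    exact zpow_le_zpow_right₀ (by norm_num) (by omega)

theorem IsDyadicMarkovKernel.eq_levelCoeff {K : ℝ → ℝ → ℝ} (hK : IsDyadicMarkovKernel K)
    {x y : ℝ} (hx : 0 ≤ x) (hy : 0 ≤ y) {j : ℤ} (h : dyadicDist x y = (2 : ℝ) ^ j) :
    K x y = levelCoeff K j :=
  hK.depends_only _ _ _ _ hx hy le_rfl (by positivity) (by rw [h, dyadicDist_zero_zpow])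

end

end DyadicMarkov

namespace DyadicMarkov

noncomputable section

/-! ### Tangent-line and Young-type inequalities for real powers. -/

section RealInequalities

/-! The theorem splits into the spectral identity `T h = λ(h) h` and the Littlewood–Paley
equivalence `‖g‖_p ≈ ‖Sg‖_p`, applied to `g = Tf`. Here `S` is the dyadic square function
`dyadicSquare`.

Off the diagonal, `K` is constant on each set of pairs whose smallest common dyadic interval has a
given level `n`. The kernel mass there, seen from any point, is `m_n = levelMass K n`, and `∑ m_n =
1`. Hence the kernel is symmetric and doubly stochastic, and Schur's test gives absolute convergence
and `Tf ∈ L^p`. A column of the kernel has mass `∑_{l>j} m_l` on the half of a level-`j` interval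
containing the point and `m_j` on the other half. Since `α_l = 2 m_l - m_{l-1}`, the difference of
the two is exactly `Λ_j` (`eigenvalue_eq`). Fubini then turns the Haar coefficients of `Tf` into
`λ(h)⟨f,h⟩` (`halfDiff_kernelOp`), so the square function of the statement equals `S(Tf)` pointwise
on `ℝ⁺` (`haarSquareFunction_eq`).

The bound `‖Sg‖_p ≤ C‖g‖_p` is proved for martingales whose increments have predictable absolute
value, which dyadic martingales have. The sum of weighted squares `v_i² d_i²` has the same integral
as the square of the martingale transform `∑ v_i d_i`, and Abel summation bounds this transform
pathwise by a maximal function. For `p ≥ 2` the weights are increasing powers of the square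
function, for `p < 2` decreasing powers of a predictable maximal function. Doob's inequality
finishes both cases (`exists_integral_sqSum_le`).

The converse bound follows by duality: dyadic differences are orthogonal across levels, so a
truncated expansion of `g` pairs with `φ ∈ L^q` by at most `‖Sg‖_p ‖Sφ‖_q`. The truncation is
removed by Lebesgue differentiation, decay of averages over large intervals, and Fatou
(`exists_eLpNorm_le_dyadicSquare`). -/

theorem mul_mul_rpow_sub_one_le {r s t : ℝ} (hr : 1 ≤ r) (hs : 0 ≤ s) (ht : 0 ≤ t) :
    r * (s * t ^ (r - 1)) ≤ s ^ r + (r - 1) * t ^ r := by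
  rcases hr.eq_or_lt with rfl | hr
  · simp
  have hconj : r.HolderConjugate (r / (r - 1)) := Real.HolderConjugate.conjExponent hr
  have h := Real.young_inequality_of_nonneg hs (Real.rpow_nonneg ht (r - 1)) hconj
  have h0 : r - 1 ≠ 0 := by linarith
  rw [← Real.rpow_mul ht, mul_div_cancel₀ _ h0] at h
  have h2 : r * (s * t ^ (r - 1)) ≤ r * (s ^ r / r + t ^ r / (r / (r - 1))) := by gcongr
  refine h2.trans (le_of_eq ?_)
  field_simp

/-- The concave power `s ↦ s ^ b` lies below its tangent line at `t`; obtained from weighted AM–GM.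
-/
theorem rpow_le_add_mul_rpow_sub_one {b s t : ℝ} (hb₀ : 0 < b) (hb₁ : b < 1) (hs : 0 ≤ s)
    (ht : 0 < t) : s ^ b ≤ (1 - b) * t ^ b + b * (s * t ^ (b - 1)) := by
  have h := Real.geom_mean_le_arith_mean2_weighted (w₁ := 1 - b) (w₂ := b) (by linarith) hb₀.le
    (Real.rpow_nonneg ht.le b) (mul_nonneg hs (Real.rpow_nonneg ht.le (b - 1))) (by ring)
  refine le_trans (le_of_eq ?_) h
  rw [Real.mul_rpow hs (Real.rpow_nonneg ht.le _), ← Real.rpow_mul ht.le, ← Real.rpow_mul ht.le,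
    mul_left_comm, ← Real.rpow_add ht]
  ring_nf
  simp

/-- Makes the Abel summation with weights `w ^ (b - 1)` telescope: the variation of the weight,
times the smaller base, is paid for by the increment of `w ^ b`. -/
theorem rpow_sub_one_sub_mul_le {b s t : ℝ} (hb₀ : 0 < b) (hb₁ : b < 1) (hs : 0 ≤ s)
    (hst : s ≤ t) : |t ^ (b - 1) - s ^ (b - 1)| * s ≤ b⁻¹ * (t ^ b - s ^ b) := by
  rcases hs.eq_or_lt with rfl | hs'
  · rw [mul_zero, Real.zero_rpow hb₀.ne', sub_zero]
    positivity
  have ht : 0 < t := hs'.trans_le hst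
  have h1 : t ^ (b - 1) ≤ s ^ (b - 1) :=
    Real.rpow_le_rpow_of_nonpos hs' hst (by linarith)
  have h2 := rpow_le_add_mul_rpow_sub_one hb₀ hb₁ hs ht
  have h3 : s ^ (b - 1) * s = s ^ b := by
    rw [← Real.rpow_add_one hs'.ne']; ring_nf
  have h4 : s ^ b ≤ t ^ b := Real.rpow_le_rpow hs hst hb₀.le
  rw [abs_of_nonpos (by linarith), le_inv_mul_iff₀ hb₀]
  nlinarith

/-- Young's inequality with a free parameter: compare `s` with `L * t`. A large `L` makes the `s`
term small enough to be absorbed into the other side of an estimate. -/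
theorem rpow_mul_rpow_le_add {a b L s t : ℝ} (ha : 0 ≤ a) (hb : 0 ≤ b) (hL : 0 < L)
    (hs : 0 ≤ s) (ht : 0 ≤ t) (hab : 0 < a + b) :
    s ^ a * t ^ b ≤ L ^ a * t ^ (a + b) + L ^ (-b) * s ^ (a + b) := by
  rcases le_total s (L * t) with h | h
  · have h1 : s ^ a * t ^ b ≤ (L * t) ^ a * t ^ b := by gcongr
    have h2 : (L * t) ^ a * t ^ b = L ^ a * t ^ (a + b) := by
      rw [Real.mul_rpow hL.le ht, Real.rpow_add' ht hab.ne', mul_assoc]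
    have h3 : 0 ≤ L ^ (-b) * s ^ (a + b) := by positivity
    linarith
  · have h0 : t ≤ L⁻¹ * s := by rwa [le_inv_mul_iff₀ hL]
    have h1 : s ^ a * t ^ b ≤ s ^ a * (L⁻¹ * s) ^ b := by gcongr
    have h2 : s ^ a * (L⁻¹ * s) ^ b = L ^ (-b) * s ^ (a + b) := by
      rw [Real.mul_rpow (by positivity) hs, Real.rpow_add' hs hab.ne', Real.rpow_neg hL.le,
        Real.inv_rpow hL.le]
      ring
    have h3 : 0 ≤ L ^ a * t ^ (a + b) := by positivity
    linarith

end RealInequalities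

/-! ### Pathwise estimates for martingales with predictable absolute increments. -/

section RegularMartingales

variable {Ω : Type*} {m : MeasurableSpace Ω}

/-- A martingale of `L^p` functions (not necessarily in `L^1`) whose increments have predictable
absolute value. -/
structure IsRegularMartingale (μ : Measure Ω) (p : ℝ) (ℱ : Filtration ℕ m) (f : ℕ → Ω → ℝ) :
    Prop where
  adapted : ∀ n, Measurable[ℱ n] (f n)
  predictable : ∀ n, Measurable[ℱ n] (fun x => |f (n + 1) x - f n x|)
  integrable : ∀ n, Integrable (fun x => |f n x| ^ p) μ
  integral_eq_zero : ∀ n (u : Ω → ℝ), Measurable[ℱ n] u →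
    Integrable (fun x => u x * (f (n + 1) x - f n x)) μ →
    ∫ x, u x * (f (n + 1) x - f n x) ∂μ = 0

/-- The running maximum of `|f i|`, `i ≤ n`. -/
def runMax (f : ℕ → Ω → ℝ) : ℕ → Ω → ℝ
  | 0, x => |f 0 x|
  | n + 1, x => max (runMax f n x) |f (n + 1) x|

/-- The running maximum of `|f i| + |f (i + 1) - f i|`, `i ≤ n`. -/
def predMax (f : ℕ → Ω → ℝ) : ℕ → Ω → ℝ
  | 0, x => |f 0 x| + |f 1 x - f 0 x|
  | n + 1, x => max (predMax f n x) (|f (n + 1) x| + |f (n + 2) x - f (n + 1) x|)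

/-- The sum of the squares of the first `n` increments. -/
def sqSum (f : ℕ → Ω → ℝ) (n : ℕ) (x : Ω) : ℝ :=
  ∑ i ∈ Finset.range n, (f (i + 1) x - f i x) ^ 2

/-- The martingale transform of `f` by `v`. -/
def transform (v f : ℕ → Ω → ℝ) (n : ℕ) (x : Ω) : ℝ :=
  ∑ i ∈ Finset.range n, v i x * (f (i + 1) x - f i x)

theorem runMax_nonneg (f : ℕ → Ω → ℝ) (n : ℕ) (x : Ω) : 0 ≤ runMax f n x := by
  cases n with
  | zero => exact abs_nonneg _
  | succ n => exact (abs_nonneg _).trans (le_max_right _ _)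

theorem runMax_mono (f : ℕ → Ω → ℝ) (x : Ω) : Monotone (fun n => runMax f n x) :=
  monotone_nat_of_le_succ fun _ => le_max_left _ _

theorem abs_le_runMax (f : ℕ → Ω → ℝ) (n : ℕ) (x : Ω) : |f n x| ≤ runMax f n x := by
  cases n with
  | zero => exact le_rfl
  | succ n => exact le_max_right _ _

theorem predMax_nonneg (f : ℕ → Ω → ℝ) (n : ℕ) (x : Ω) : 0 ≤ predMax f n x := by
  cases n with
  | zero => exact add_nonneg (abs_nonneg _) (abs_nonneg _)
  | succ n => exact (add_nonneg (abs_nonneg _) (abs_nonneg _)).trans (le_max_right _ _)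

theorem predMax_mono (f : ℕ → Ω → ℝ) (x : Ω) : Monotone (fun n => predMax f n x) :=
  monotone_nat_of_le_succ fun _ => le_max_left _ _

theorem add_abs_le_predMax (f : ℕ → Ω → ℝ) (n : ℕ) (x : Ω) :
    |f n x| + |f (n + 1) x - f n x| ≤ predMax f n x := by
  cases n with
  | zero => exact le_rfl
  | succ n => exact le_max_right _ _

/-- The point of `predMax`: it is known at time `n` when absolute increments are predictable, yet it
already controls the value at time `n + 1`. -/
theorem abs_succ_le_predMax (f : ℕ → Ω → ℝ) (n : ℕ) (x : Ω) :
    |f (n + 1) x| ≤ predMax f n x := by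
  refine le_trans ?_ (add_abs_le_predMax f n x)
  calc |f (n + 1) x| = |f n x + (f (n + 1) x - f n x)| := by ring_nf
    _ ≤ _ := abs_add_le _ _

theorem abs_sub_le_runMax (f : ℕ → Ω → ℝ) (n : ℕ) (x : Ω) :
    |f (n + 1) x - f n x| ≤ 2 * runMax f (n + 1) x := by
  have h1 := abs_sub (f (n + 1) x) (f n x)
  have h2 := abs_le_runMax f (n + 1) x
  have h3 := (abs_le_runMax f n x).trans (runMax_mono f x n.le_succ)
  simp only at h3
  linarith

theorem predMax_le_runMax (f : ℕ → Ω → ℝ) (n : ℕ) (x : Ω) :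
    predMax f n x ≤ 3 * runMax f (n + 1) x := by
  have key : ∀ n, |f n x| + |f (n + 1) x - f n x| ≤ 3 * runMax f (n + 1) x := fun n => by
    have h1 := abs_sub_le_runMax f n x
    have h3 := (abs_le_runMax f n x).trans (runMax_mono f x n.le_succ)
    simp only at h3
    linarith
  induction n with
  | zero => exact key 0
  | succ n ih =>
    refine max_le (ih.trans ?_) (key _)
    have := runMax_mono f x (n + 1).le_succ
    simp only at this
    linarith

theorem sqSum_nonneg (f : ℕ → Ω → ℝ) (n : ℕ) (x : Ω) : 0 ≤ sqSum f n x :=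
  Finset.sum_nonneg fun _ _ => sq_nonneg _

theorem sqSum_succ (f : ℕ → Ω → ℝ) (n : ℕ) (x : Ω) :
    sqSum f (n + 1) x = sqSum f n x + (f (n + 1) x - f n x) ^ 2 := Finset.sum_range_succ _ _

theorem sqSum_mono (f : ℕ → Ω → ℝ) (x : Ω) : Monotone (fun n => sqSum f n x) :=
  monotone_nat_of_le_succ fun n => by
    simp only [sqSum_succ]; linarith [sq_nonneg (f (n + 1) x - f n x)]

/-- Crude and dependent on `n`; it serves only to make powers of the square function integrable, so
that absorption is legitimate. -/
theorem sqSum_le_runMax (f : ℕ → Ω → ℝ) (n : ℕ) (x : Ω) :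
    sqSum f n x ≤ 4 * n * runMax f n x ^ 2 := by
  induction n with
  | zero => simp [sqSum]
  | succ n ih =>
    have h1 := abs_sub_le_runMax f n x
    have h2 : runMax f n x ≤ runMax f (n + 1) x := runMax_mono f x n.le_succ
    have h3 : (f (n + 1) x - f n x) ^ 2 ≤ (2 * runMax f (n + 1) x) ^ 2 := by
      rw [← sq_abs]; gcongr
    have h4 : runMax f n x ^ 2 ≤ runMax f (n + 1) x ^ 2 := by
      have := runMax_nonneg f n x
      gcongr
    rw [sqSum_succ]
    push_cast
    have h5 : 4 * (n : ℝ) * runMax f n x ^ 2 ≤ 4 * (n : ℝ) * runMax f (n + 1) x ^ 2 := by gcongr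
    linarith

theorem transform_succ (v f : ℕ → Ω → ℝ) (n : ℕ) (x : Ω) :
    transform v f (n + 1) x = transform v f n x + v n x * (f (n + 1) x - f n x) :=
  Finset.sum_range_succ _ _

/-- Pathwise form of Doob's maximal inequality. -/
theorem doob_pathwise {p : ℝ} (hp : 1 < p) (f : ℕ → Ω → ℝ) (n : ℕ) (x : Ω) :
    p * ∑ i ∈ Finset.range n, runMax f i x ^ (p - 1) * (|f (i + 1) x| - |f i x|) ≤
      p * (runMax f n x ^ (p - 1) * |f n x|) - (p - 1) * runMax f n x ^ p := by
  have hpow : ∀ t : ℝ, 0 ≤ t → t ^ (p - 1) * t = t ^ p := fun t ht => by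
    conv_rhs => rw [show p = (p - 1) + 1 by ring, Real.rpow_add_one' ht (by linarith)]
  induction n with
  | zero =>
    have h : runMax f 0 x = |f 0 x| := rfl
    rw [h, hpow _ (abs_nonneg _)]
    have : 0 ≤ |f 0 x| ^ p := by positivity
    simp only [Finset.range_zero, Finset.sum_empty]
    linarith
  | succ n ih =>
    rw [Finset.sum_range_succ]
    have h0 := runMax_nonneg f n x
    rcases le_total |f (n + 1) x| (runMax f n x) with h | h
    · have : runMax f (n + 1) x = runMax f n x := max_eq_left h
      rw [this]
      linarith
    · have : runMax f (n + 1) x = |f (n + 1) x| := max_eq_right h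
      rw [this, hpow _ (abs_nonneg _)]
      -- When the maximum is renewed, the new term is controlled by the tangent line of the convex
      -- power at the old maximum.
      have hy := mul_mul_rpow_sub_one_le hp.le (abs_nonneg (f (n + 1) x)) h0
      linarith

/-- Abel summation for increasing multipliers. -/
theorem abs_transform_le_of_monotone {v f : ℕ → Ω → ℝ} {x : Ω} (hv₀ : 0 ≤ v 0 x)
    (hv : Monotone fun n => v n x) (n : ℕ) :
    |transform v f (n + 1) x| ≤ 2 * (v n x * runMax f (n + 1) x) := by
  have hvn : ∀ n, 0 ≤ v n x := fun n => hv₀.trans (hv n.zero_le)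
  -- What remains after removing the boundary term is `-v₀ f₀ - ∑ (v_{i+1} - v_i) f_{i+1}`. The
  -- coefficients have one sign, so their absolute values telescope to `v_n`.
  have key : |transform v f (n + 1) x - v n x * f (n + 1) x| ≤ v n x * runMax f n x := by
    induction n with
    | zero =>
      have : transform v f (0 + 1) x - v 0 x * f (0 + 1) x = -(v 0 x * f 0 x) := by
        simp [transform]; ring
      rw [this, abs_neg, abs_mul, abs_of_nonneg hv₀]
      exact le_rfl
    | succ n ih =>
      have h1 : transform v f (n + 1 + 1) x - v (n + 1) x * f (n + 1 + 1) x =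
          (transform v f (n + 1) x - v n x * f (n + 1) x) -
            (v (n + 1) x - v n x) * f (n + 1) x := by
        rw [transform_succ]; ring
      have h2 : 0 ≤ v (n + 1) x - v n x := sub_nonneg.2 (hv n.le_succ)
      have h3 : runMax f n x ≤ runMax f (n + 1) x := runMax_mono f x n.le_succ
      have h4 := abs_le_runMax f (n + 1) x
      rw [h1]
      refine (abs_sub _ _).trans ?_
      rw [abs_mul, abs_of_nonneg h2]
      have h5 : v n x * runMax f n x ≤ v n x * runMax f (n + 1) x :=
        mul_le_mul_of_nonneg_left h3 (hvn n)
      have h6 := mul_le_mul_of_nonneg_left h4 h2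
      linarith
  have h1 : |v n x * f (n + 1) x| ≤ v n x * runMax f (n + 1) x := by
    rw [abs_mul, abs_of_nonneg (hvn n)]
    exact mul_le_mul_of_nonneg_left (abs_le_runMax f (n + 1) x) (hvn n)
  have h2 : v n x * runMax f n x ≤ v n x * runMax f (n + 1) x :=
    mul_le_mul_of_nonneg_left (runMax_mono f x n.le_succ) (hvn n)
  have h3 := abs_add_le (transform v f (n + 1) x - v n x * f (n + 1) x) (v n x * f (n + 1) x)
  rw [sub_add_cancel] at h3
  linarith

theorem predMax_rpow_mul {b : ℝ} (hb : 0 < b) (f : ℕ → Ω → ℝ) (n : ℕ) (x : Ω) :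
    predMax f n x ^ (b - 1) * predMax f n x = predMax f n x ^ b := by
  conv_rhs => rw [show b = (b - 1) + 1 by ring,
    Real.rpow_add_one' (predMax_nonneg f n x) (by linarith)]

/-- Abel summation for the decreasing multipliers `predMax f n ^ (b - 1)`. -/
theorem abs_transform_predMax_le {b : ℝ} (hb₀ : 0 < b) (hb₁ : b < 1) (f : ℕ → Ω → ℝ) (n : ℕ)
    (x : Ω) :
    |transform (fun i y => predMax f i y ^ (b - 1)) f (n + 1) x| ≤
      (b⁻¹ + 1) * predMax f n x ^ b := by
  set v : ℕ → Ω → ℝ := fun i y => predMax f i y ^ (b - 1) with hv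
  have hb1 : 1 ≤ b⁻¹ := (one_le_inv₀ hb₀).2 hb₁.le
  have hv0 : ∀ n, 0 ≤ v n x := fun n => Real.rpow_nonneg (predMax_nonneg f n x) _
  have hvw : ∀ n, v n x * predMax f n x = predMax f n x ^ b := fun n => predMax_rpow_mul hb₀ f n x
  have key : |transform v f (n + 1) x - v n x * f (n + 1) x| ≤ b⁻¹ * predMax f n x ^ b := by
    induction n with
    | zero =>
      have : transform v f (0 + 1) x - v 0 x * f (0 + 1) x = -(v 0 x * f 0 x) := by
        simp [transform]; ring
      rw [this, abs_neg, abs_mul, abs_of_nonneg (hv0 0)]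
      have h1 : |f 0 x| ≤ predMax f 0 x :=
        (le_add_of_nonneg_right (abs_nonneg _)).trans (add_abs_le_predMax f 0 x)
      have h2 := mul_le_mul_of_nonneg_left h1 (hv0 0)
      rw [hvw] at h2
      have h3 : 0 ≤ predMax f 0 x ^ b := Real.rpow_nonneg (predMax_nonneg f 0 x) _
      nlinarith
    | succ n ih =>
      have h1 : transform v f (n + 1 + 1) x - v (n + 1) x * f (n + 1 + 1) x =
          (transform v f (n + 1) x - v n x * f (n + 1) x) -
            (v (n + 1) x - v n x) * f (n + 1) x := by
        rw [transform_succ]; ring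
      -- The variation of the weight is measured against `predMax f n`, not `predMax f (n + 1)`,
      -- which is enough because `|f (n + 1)| ≤ predMax f n`.
      have h2 : |v (n + 1) x - v n x| * predMax f n x ≤
          b⁻¹ * (predMax f (n + 1) x ^ b - predMax f n x ^ b) :=
        rpow_sub_one_sub_mul_le hb₀ hb₁ (predMax_nonneg f n x) (predMax_mono f x n.le_succ)
      rw [h1]
      refine (abs_sub _ _).trans ?_
      rw [abs_mul]
      have h3 := mul_le_mul_of_nonneg_left (abs_succ_le_predMax f n x)
        (abs_nonneg (v (n + 1) x - v n x))
      linarith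
  have h1 : |v n x * f (n + 1) x| ≤ predMax f n x ^ b := by
    rw [abs_mul, abs_of_nonneg (hv0 n), ← hvw]
    exact mul_le_mul_of_nonneg_left (abs_succ_le_predMax f n x) (hv0 n)
  have h3 := abs_add_le (transform v f (n + 1) x - v n x * f (n + 1) x) (v n x * f (n + 1) x)
  rw [sub_add_cancel] at h3
  linarith

/-! ### Doob's inequality and `L^p` bounds for the martingale square function. -/

namespace IsRegularMartingale

variable {μ : Measure Ω} {p : ℝ} {ℱ : Filtration ℕ m} {f : ℕ → Ω → ℝ}

theorem measurable_runMax (h : IsRegularMartingale μ p ℱ f) (n : ℕ) :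
    Measurable[ℱ n] (runMax f n) := by
  induction n with
  | zero => exact continuous_abs.measurable.comp (h.adapted 0)
  | succ n ih =>
    exact Measurable.max (ih.mono (ℱ.mono n.le_succ) le_rfl)
      (continuous_abs.measurable.comp (h.adapted (n + 1)))

theorem measurable_predMax (h : IsRegularMartingale μ p ℱ f) (n : ℕ) :
    Measurable[ℱ n] (predMax f n) := by
  induction n with
  | zero => exact (continuous_abs.measurable.comp (h.adapted 0)).add (h.predictable 0)
  | succ n ih =>
    exact Measurable.max (ih.mono (ℱ.mono n.le_succ) le_rfl)
      ((continuous_abs.measurable.comp (h.adapted (n + 1))).add (h.predictable (n + 1)))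

theorem measurable_sub (h : IsRegularMartingale μ p ℱ f) (n : ℕ) :
    Measurable[ℱ (n + 1)] (fun x => f (n + 1) x - f n x) :=
  (h.adapted (n + 1)).sub ((h.adapted n).mono (ℱ.mono n.le_succ) le_rfl)

/-- Predictability of `|f (n + 1) - f n|` makes the square sum through this increment known at time
`n`, so its powers are admissible multipliers. -/
theorem measurable_sqSum_succ (h : IsRegularMartingale μ p ℱ f) (n : ℕ) :
    Measurable[ℱ n] (sqSum f (n + 1)) := by
  have h2 : ∀ n, Measurable[ℱ n] (fun x => (f (n + 1) x - f n x) ^ 2) := fun n => by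
    have := (h.predictable n).pow_const 2
    simpa only [sq_abs] using this
  induction n with
  | zero => simpa [funext (sqSum_succ f 0), sqSum] using h2 0
  | succ n ih =>
    rw [funext (sqSum_succ f (n + 1))]
    exact (ih.mono (ℱ.mono n.le_succ) le_rfl).add (h2 (n + 1))

theorem measurable_transform {v : ℕ → Ω → ℝ} (h : IsRegularMartingale μ p ℱ f)
    (hv : ∀ n, Measurable[ℱ n] (v n)) (n : ℕ) : Measurable[ℱ n] (transform v f n) := by
  induction n with
  | zero => exact measurable_const (a := (0 : ℝ))
  | succ n ih =>
    rw [funext (transform_succ v f n)]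
    exact (ih.mono (ℱ.mono n.le_succ) le_rfl).add
      (((hv n).mono (ℱ.mono n.le_succ) le_rfl).mul (h.measurable_sub n))

theorem integrable_runMax_rpow (h : IsRegularMartingale μ p ℱ f) (n : ℕ) :
    Integrable (fun x => runMax f n x ^ p) μ := by
  induction n with
  | zero => exact h.integrable 0
  | succ n ih =>
    refine (ih.add (h.integrable (n + 1))).mono'
      (((h.measurable_runMax (n + 1)).mono (ℱ.le _) le_rfl).pow_const p).aestronglyMeasurable
      (ae_of_all _ fun x => ?_)
    rw [Real.norm_of_nonneg (Real.rpow_nonneg (runMax_nonneg _ _ _) _)]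
    have h1 : 0 ≤ runMax f n x ^ p := Real.rpow_nonneg (runMax_nonneg _ _ _) _
    have h2 : 0 ≤ |f (n + 1) x| ^ p := by positivity
    simp only [Pi.add_apply]
    rcases max_choice (runMax f n x) |f (n + 1) x| with h3 | h3
    · simp only [runMax, h3]; linarith
    · simp only [runMax, h3]; linarith

/-- A measurable function dominated by a multiple of `runMax f n ^ p` is integrable. -/
theorem integrable_of_le (h : IsRegularMartingale μ p ℱ f) (n : ℕ) {u : Ω → ℝ} (C : ℝ)
    (hu : Measurable u) (hC : ∀ x, |u x| ≤ C * runMax f n x ^ p) : Integrable u μ :=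
  ((h.integrable_runMax_rpow n).const_mul C).mono' hu.aestronglyMeasurable (ae_of_all _ hC)

theorem measurable' (h : IsRegularMartingale μ p ℱ f) (n : ℕ) : Measurable (f n) :=
  (h.adapted n).mono (ℱ.le n) le_rfl

/-- The submartingale property of `|f|`: test the martingale identity against `u * sign (f n)` and
use `sign (f n) * f (n + 1) ≤ |f (n + 1)|`. -/
theorem integral_mul_abs_sub_nonneg (h : IsRegularMartingale μ p ℱ f) (n : ℕ) {u : Ω → ℝ}
    (hu : Measurable[ℱ n] u) (hu₀ : ∀ x, 0 ≤ u x)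
    (hi : Integrable (fun x => u x * |f n x|) μ)
    (hi' : Integrable (fun x => u x * |f (n + 1) x|) μ) :
    0 ≤ ∫ x, u x * (|f (n + 1) x| - |f n x|) ∂μ := by
  have hsgn : Measurable[ℱ n] (fun x => u x * SignType.sign (f n x)) := by
    refine hu.mul ?_
    have : Measurable (fun y : ℝ => ((SignType.sign y : SignType) : ℝ)) := by
      have h1 : (fun y : ℝ => ((SignType.sign y : SignType) : ℝ)) =
          fun y => if 0 < y then 1 else if y < 0 then -1 else 0 := by
        funext y
        rw [sign_apply]
        split_ifs <;> simp
      rw [h1]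
      exact Measurable.ite measurableSet_Ioi measurable_const
        (Measurable.ite measurableSet_Iio measurable_const measurable_const)
    exact this.comp (h.adapted n)
  have habs : ∀ x, |((SignType.sign (f n x) : SignType) : ℝ)| ≤ 1 := fun x => by
    rcases lt_trichotomy (f n x) 0 with h | h | h
    · simp [sign_neg h]
    · simp [h]
    · simp [sign_pos h]
  have hdom : Integrable
      (fun x => u x * SignType.sign (f n x) * (f (n + 1) x - f n x)) μ := by
    refine (hi'.add hi).mono' (((hsgn.mono (ℱ.le n) le_rfl).mul
      ((h.measurable_sub n).mono (ℱ.le _) le_rfl)).aestronglyMeasurable) (ae_of_all _ fun x => ?_)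
    rw [Real.norm_eq_abs, abs_mul, abs_mul, abs_of_nonneg (hu₀ x)]
    have h1 := abs_sub (f (n + 1) x) (f n x)
    calc u x * |((SignType.sign (f n x) : SignType) : ℝ)| * |f (n + 1) x - f n x|
        ≤ u x * 1 * (|f (n + 1) x| + |f n x|) := by
          gcongr
          · exact mul_nonneg (hu₀ x) zero_le_one
          · exact hu₀ x
          · exact habs x
      _ = _ := by simp only [Pi.add_apply]; ring
  rw [← h.integral_eq_zero n _ hsgn hdom]
  refine integral_mono hdom ?_ fun x => ?_
  · exact (hi'.sub hi).congr (ae_of_all _ fun x => (mul_sub _ _ _).symm)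
  · simp only
    rw [mul_assoc]
    refine mul_le_mul_of_nonneg_left ?_ (hu₀ x)
    rw [mul_sub, sign_mul_self]
    refine sub_le_sub_right ((le_abs_self _).trans ?_) _
    rw [abs_mul]
    exact mul_le_of_le_one_left (abs_nonneg _) (habs x)

/-- Doob's maximal inequality in `L^p`. -/
theorem integral_runMax_le (h : IsRegularMartingale μ p ℱ f) (hp : 1 < p) (n : ℕ) :
    ∫ x, runMax f n x ^ p ∂μ ≤ (2 * p / (p - 1)) ^ p * ∫ x, |f n x| ^ p ∂μ := by
  have hp1 : 0 < p - 1 := by linarith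
  have hmeas : ∀ i, Measurable (runMax f i) := fun i =>
    (h.measurable_runMax i).mono (ℱ.le i) le_rfl
  have hmi : ∀ i j, i ≤ n → j ≤ n →
      Integrable (fun x => runMax f i x ^ (p - 1) * |f j x|) μ := fun i j hi hj => by
    refine h.integrable_of_le n 1 (((hmeas i).pow_const _).mul (h.measurable' j).abs) fun x => ?_
    have h0 := runMax_nonneg f i x
    have h1 : |f j x| ≤ runMax f n x := (abs_le_runMax f j x).trans (runMax_mono f x hj)
    have h2 : runMax f i x ≤ runMax f n x := runMax_mono f x hi
    have h3 := runMax_nonneg f n x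
    rw [abs_of_nonneg (by positivity), one_mul]
    calc runMax f i x ^ (p - 1) * |f j x| ≤ runMax f n x ^ (p - 1) * runMax f n x := by gcongr
      _ = runMax f n x ^ p := by
        conv_rhs => rw [show p = (p - 1) + 1 by ring, Real.rpow_add_one' h3 (by linarith)]
  have hsum : 0 ≤ ∫ x, p * ∑ i ∈ Finset.range n,
      runMax f i x ^ (p - 1) * (|f (i + 1) x| - |f i x|) ∂μ := by
    rw [integral_const_mul, integral_finsetSum]
    · refine mul_nonneg (by linarith) (Finset.sum_nonneg fun i hi => ?_)
      have hi := Finset.mem_range.1 hi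
      exact h.integral_mul_abs_sub_nonneg i ((h.measurable_runMax i).pow_const _)
        (fun x => Real.rpow_nonneg (runMax_nonneg f i x) _) (hmi i i hi.le hi.le)
        (hmi i (i + 1) hi.le hi)
    · intro i hi
      have hi := Finset.mem_range.1 hi
      exact ((hmi i (i + 1) hi.le hi).sub (hmi i i hi.le hi.le)).congr
        (ae_of_all _ fun x => (mul_sub _ _ _).symm)
  -- Chosen so that `p / L = (p - 1) / 2`: Young's inequality then consumes exactly half of the `(p
  -- - 1) * runMax ^ p` term.
  set L : ℝ := 2 * p / (p - 1) with hL
  have hLpos : 0 < L := by positivity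
  have hle : ∫ x, p * ∑ i ∈ Finset.range n,
      runMax f i x ^ (p - 1) * (|f (i + 1) x| - |f i x|) ∂μ ≤
      ∫ x, (p * L ^ (p - 1) * |f n x| ^ p - (p - 1) / 2 * runMax f n x ^ p) ∂μ := by
    refine integral_mono (Integrable.const_mul (integrable_finsetSum _ fun i hi => ?_) _)
      (((h.integrable n).const_mul _).sub ((h.integrable_runMax_rpow n).const_mul _)) fun x => ?_
    · have hi := Finset.mem_range.1 hi
      exact ((hmi i (i + 1) hi.le hi).sub (hmi i i hi.le hi.le)).congr
        (ae_of_all _ fun x => (mul_sub _ _ _).symm)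
    · refine (doob_pathwise hp f n x).trans ?_
      have hy := rpow_mul_rpow_le_add hp1.le zero_le_one hLpos (runMax_nonneg f n x)
        (abs_nonneg (f n x)) (by linarith)
      rw [Real.rpow_one, sub_add_cancel, Real.rpow_neg_one] at hy
      have hy' := mul_le_mul_of_nonneg_left hy (by linarith : 0 ≤ p)
      have hLi : p * L⁻¹ = (p - 1) / 2 := by rw [hL]; field_simp
      have : p * (L ^ (p - 1) * |f n x| ^ p + L⁻¹ * runMax f n x ^ p) =
        p * L ^ (p - 1) * |f n x| ^ p + (p - 1) / 2 * runMax f n x ^ p := by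
        rw [← hLi]; ring
      linarith
  rw [integral_sub ((h.integrable n).const_mul _) ((h.integrable_runMax_rpow n).const_mul _),
    integral_const_mul (p * L ^ (p - 1)), integral_const_mul ((p - 1) / 2)] at hle
  have hfin : (p - 1) / 2 * ∫ x, runMax f n x ^ p ∂μ ≤
      (p - 1) / 2 * (L ^ p * ∫ x, |f n x| ^ p ∂μ) := by
    have : (p - 1) / 2 * (L ^ p * ∫ x, |f n x| ^ p ∂μ) =
        p * L ^ (p - 1) * ∫ x, |f n x| ^ p ∂μ := by
      have hLp : L ^ p = L ^ (p - 1) * L := by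
        rw [← Real.rpow_add_one hLpos.ne', sub_add_cancel]
      rw [hLp]
      nth_rewrite 2 [hL]
      field_simp
    linarith
  exact le_of_mul_le_mul_left hfin (by positivity)

/-- Martingale transforms have orthogonal increments. -/
theorem integral_transform_sq {v : ℕ → Ω → ℝ} (h : IsRegularMartingale μ p ℱ f)
    (hv : ∀ n, Measurable[ℱ n] (v n))
    (hi : ∀ n, Integrable (fun x => (v n x * (f (n + 1) x - f n x)) ^ 2) μ) (n : ℕ) :
    Integrable (fun x => transform v f n x ^ 2) μ ∧
    ∫ x, transform v f n x ^ 2 ∂μ =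
      ∫ x, ∑ i ∈ Finset.range n, (v i x * (f (i + 1) x - f i x)) ^ 2 ∂μ := by
  have hmd : ∀ n, Measurable (fun x => v n x * (f (n + 1) x - f n x)) := fun n =>
    ((hv n).mono (ℱ.le n) le_rfl).mul ((h.measurable_sub n).mono (ℱ.le _) le_rfl)
  have hL : ∀ n, MemLp (fun x => v n x * (f (n + 1) x - f n x)) 2 μ := fun n =>
    (memLp_two_iff_integrable_sq (hmd n).aestronglyMeasurable).2 (hi n)
  have hT : ∀ n, MemLp (transform v f n) 2 μ := fun n => by
    have : transform v f n = fun x => ∑ i ∈ Finset.range n, v i x * (f (i + 1) x - f i x) := rfl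
    rw [this]
    exact memLp_finsetSum _ fun i _ => hL i
  refine ⟨(hT n).integrable_sq, ?_⟩
  induction n with
  | zero => simp [transform]
  | succ n ih =>
    have hcross : Integrable
        (fun x => (2 * transform v f n x * v n x) * (f (n + 1) x - f n x)) μ := by
      have := ((hT n).integrable_mul (hL n)).const_mul 2
      refine this.congr (ae_of_all _ fun x => ?_)
      simp only [Pi.mul_apply]; ring
    have hzero := h.integral_eq_zero n (fun x => 2 * transform v f n x * v n x)
      (((h.measurable_transform hv n).const_mul 2).mul (hv n)) hcross
    have hexp : ∀ x, transform v f (n + 1) x ^ 2 = (transform v f n x ^ 2 +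
        (2 * transform v f n x * v n x) * (f (n + 1) x - f n x)) +
        (v n x * (f (n + 1) x - f n x)) ^ 2 := fun x => by
      rw [transform_succ]; ring
    simp only [hexp, Finset.sum_range_succ]
    have hadd : Integrable (fun x => transform v f n x ^ 2 +
        (2 * transform v f n x * v n x) * (f (n + 1) x - f n x)) μ :=
      (hT n).integrable_sq.add hcross
    rw [integral_add hadd (hi n),
      integral_add (hT n).integrable_sq hcross, hzero, add_zero, ih,
      integral_add (integrable_finsetSum _ fun i _ => hi i) (hi n)]

theorem measurable_sqSum (h : IsRegularMartingale μ p ℱ f) (n : ℕ) : Measurable (sqSum f n) :=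
  Finset.measurable_fun_sum _ fun i _ =>
    ((h.measurable' (i + 1)).sub (h.measurable' i)).pow_const 2

theorem integrable_sqSum_rpow (h : IsRegularMartingale μ p ℱ f) (hp : 1 < p) (n : ℕ) :
    Integrable (fun x => sqSum f n x ^ (p / 2)) μ := by
  refine h.integrable_of_le n ((4 * n) ^ (p / 2)) ((h.measurable_sqSum n).pow_const _) fun x => ?_
  have h0 := sqSum_nonneg f n x
  have h1 := runMax_nonneg f n x
  rw [abs_of_nonneg (by positivity)]
  calc sqSum f n x ^ (p / 2) ≤ (4 * n * runMax f n x ^ 2) ^ (p / 2) := by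
        gcongr; exact sqSum_le_runMax f n x
    _ = _ := by
      rw [Real.mul_rpow (by positivity) (by positivity), ← Real.rpow_natCast_mul h1]
      congr 2
      push_cast; ring

/-- With `s` the square sum, convexity gives `s_n^{p/2} ≤ (p/2) ∑ s_{i+1}^{(p-2)/2} d_i²`. The right
side integrates to `p/2` times the square of a transform with increasing multipliers, which Abel
summation bounds by `4 s_n^{(p-2)/2} M_n²`, where `M` is `runMax`. Young's inequality and absorption
conclude. -/
theorem integral_sqSum_le_of_two_le (h : IsRegularMartingale μ p ℱ f) (hp : 2 ≤ p) (n : ℕ) :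
    ∫ x, sqSum f n x ^ (p / 2) ∂μ ≤
      4 * p * (4 * p) ^ ((p - 2) / 2) * ∫ x, runMax f n x ^ p ∂μ := by
  set v : ℕ → Ω → ℝ := fun i x => sqSum f (i + 1) x ^ ((p - 2) / 4) with hv
  have hvm : ∀ i, Measurable[ℱ i] (v i) := fun i => (h.measurable_sqSum_succ i).pow_const _
  have hv2 : ∀ i x, v i x ^ 2 = sqSum f (i + 1) x ^ ((p - 2) / 2) := fun i x => by
    rw [hv, ← Real.rpow_mul_natCast (sqSum_nonneg _ _ _)]
    congr 1
    push_cast; ring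
  have hpow : ∀ t : ℝ, 0 ≤ t → t ^ ((p - 2) / 2) * t = t ^ (p / 2) := fun t ht => by
    rw [show p / 2 = (p - 2) / 2 + 1 by ring, Real.rpow_add_one' ht (by linarith)]
  have hvi : ∀ i, Integrable (fun x => (v i x * (f (i + 1) x - f i x)) ^ 2) μ := fun i => by
    refine (h.integrable_sqSum_rpow (by linarith) (i + 1)).mono'
      ((((hvm i).mono (ℱ.le i) le_rfl).mul
        ((h.measurable' (i + 1)).sub (h.measurable' i))).pow_const 2).aestronglyMeasurable
      (ae_of_all _ fun x => ?_)
    have h0 := sqSum_nonneg f (i + 1) x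
    rw [Real.norm_of_nonneg (sq_nonneg _), mul_pow, hv2, ← hpow _ h0]
    refine mul_le_mul_of_nonneg_left ?_ (Real.rpow_nonneg h0 _)
    rw [sqSum_succ]
    linarith [sqSum_nonneg f i x]
  have hpath : ∀ k x, sqSum f k x ^ (p / 2) ≤
      p / 2 * ∑ i ∈ Finset.range k, (v i x * (f (i + 1) x - f i x)) ^ 2 := fun k x => by
    induction k with
    | zero => simp [sqSum, Real.zero_rpow (by linarith : p / 2 ≠ 0)]
    | succ k ih =>
      rw [Finset.sum_range_succ, mul_pow, hv2]
      have h0 := sqSum_nonneg f k x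
      have h1 := sqSum_nonneg f (k + 1) x
      have hy := mul_mul_rpow_sub_one_le (by linarith : 1 ≤ p / 2) h0 h1
      have h2 : (f (k + 1) x - f k x) ^ 2 = sqSum f (k + 1) x - sqSum f k x := by
        rw [sqSum_succ]; ring
      rw [show p / 2 - 1 = (p - 2) / 2 by ring] at hy
      have h3 := hpow _ h1
      rw [h2, mul_add, mul_sub, h3]
      linarith
  have hr := h.integrable_runMax_rpow n
  have hS := h.integrable_sqSum_rpow (by linarith) n
  have hmain : ∫ x, sqSum f n x ^ (p / 2) ∂μ ≤
      ∫ x, (2 * p * (4 * p) ^ ((p - 2) / 2) * runMax f n x ^ p +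
        1 / 2 * sqSum f n x ^ (p / 2)) ∂μ := by
    obtain ⟨hTi, hTe⟩ := h.integral_transform_sq hvm hvi n
    calc ∫ x, sqSum f n x ^ (p / 2) ∂μ
        ≤ ∫ x, p / 2 * ∑ i ∈ Finset.range n, (v i x * (f (i + 1) x - f i x)) ^ 2 ∂μ :=
          integral_mono hS ((integrable_finsetSum _ fun i _ => hvi i).const_mul _) (hpath n)
      _ = ∫ x, p / 2 * transform v f n x ^ 2 ∂μ := by
          rw [integral_const_mul, integral_const_mul, hTe]
      _ ≤ _ := by
          refine integral_mono (hTi.const_mul _) ((hr.const_mul _).add (hS.const_mul _))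
            fun x => ?_
          simp only
          have h1 := runMax_nonneg f n x
          have h2 := sqSum_nonneg f n x
          cases n with
          | zero =>
            simp only [transform, Finset.range_zero, Finset.sum_empty]
            have : (0 : ℝ) ^ 2 = 0 := by norm_num
            rw [this, mul_zero]
            positivity
          | succ k =>
            have hT := abs_transform_le_of_monotone (v := v) (f := f) (x := x)
              (Real.rpow_nonneg (sqSum_nonneg _ _ _) _)
              (fun i j hij => Real.rpow_le_rpow (sqSum_nonneg _ _ _)
                (sqSum_mono f x (by omega)) (by linarith)) k
            have hT2 : transform v f (k + 1) x ^ 2 ≤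
                4 * (sqSum f (k + 1) x ^ ((p - 2) / 2) * runMax f (k + 1) x ^ 2) := by
              rw [← sq_abs, ← hv2]
              calc _ ≤ (2 * (v k x * runMax f (k + 1) x)) ^ 2 := by gcongr
                _ = _ := by ring
            -- The total factor in front is `p / 2 * 4 = 2 * p`, so `L = 4 * p` leaves exactly half
            -- of the square function to absorb.
            have hY := rpow_mul_rpow_le_add (a := (p - 2) / 2) (b := 1) (L := 4 * p)
              (by linarith) zero_le_one (by linarith) h2 (sq_nonneg (runMax f (k + 1) x))
              (by linarith)
            rw [Real.rpow_one, show (p - 2) / 2 + 1 = p / 2 by ring, Real.rpow_neg_one,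
              ← Real.rpow_natCast_mul h1] at hY
            have e1 : ((2 : ℕ) : ℝ) * (p / 2) = p := by push_cast; ring
            rw [e1] at hY
            have hp0 : 0 < p := by linarith
            calc p / 2 * transform v f (k + 1) x ^ 2
                ≤ p / 2 * (4 * ((4 * p) ^ ((p - 2) / 2) * runMax f (k + 1) x ^ p +
                    (4 * p)⁻¹ * sqSum f (k + 1) x ^ (p / 2))) := by
                  gcongr
                  linarith
              _ = _ := by field_simp; norm_num
  rw [integral_add (hr.const_mul _) (hS.const_mul _), integral_const_mul, integral_const_mul]
    at hmain
  linarith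

theorem integrable_predMax_rpow (h : IsRegularMartingale μ p ℱ f) (hp : 0 < p) (n : ℕ) :
    Integrable (fun x => predMax f n x ^ p) μ := by
  refine h.integrable_of_le (n + 1) (3 ^ p)
    (((h.measurable_predMax n).mono (ℱ.le n) le_rfl).pow_const _) fun x => ?_
  have h0 := predMax_nonneg f n x
  rw [abs_of_nonneg (by positivity), ← Real.mul_rpow (by norm_num) (runMax_nonneg _ _ _)]
  exact Real.rpow_le_rpow h0 (predMax_le_runMax f n x) hp.le

/-- With `w = predMax f`, concavity bounds `s^{p/2}` by `w^p + s w^{p-2}`. Since `w^{p-2}` decreases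
in time, `s w^{p-2}` is at most the sum of the `w_i^{p-2} d_i²`, whose integral is that of a squared
transform bounded pathwise by a multiple of `w^p`. No absorption is needed. The constant is `90 = (9
+ 1) * 9`, the last factor from `w ≤ 3 * runMax` and `3^p ≤ 9`. -/
theorem integral_sqSum_le_of_lt_two (h : IsRegularMartingale μ p ℱ f) (hp : 1 < p) (hp₂ : p < 2)
    (n : ℕ) :
    ∫ x, sqSum f n x ^ (p / 2) ∂μ ≤ 90 * ∫ x, runMax f n x ^ p ∂μ := by
  cases n with
  | zero =>
    have : ∀ x, sqSum f 0 x ^ (p / 2) = 0 := fun x => by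
      simp [sqSum, Real.zero_rpow (by linarith : p / 2 ≠ 0)]
    simp only [this, integral_zero]
    exact mul_nonneg (by norm_num)
      (integral_nonneg fun x => Real.rpow_nonneg (runMax_nonneg f 0 x) _)
  | succ k =>
  set v : ℕ → Ω → ℝ := fun i x => predMax f i x ^ (p / 2 - 1) with hv
  have hvm : ∀ i, Measurable[ℱ i] (v i) := fun i => (h.measurable_predMax i).pow_const _
  have hv2 : ∀ i x, v i x ^ 2 = predMax f i x ^ (p - 2) := fun i x => by
    rw [hv, ← Real.rpow_mul_natCast (predMax_nonneg _ _ _)]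
    congr 1
    push_cast; ring
  have hdw : ∀ i x, |f (i + 1) x - f i x| ≤ predMax f i x := fun i x =>
    (le_add_of_nonneg_left (abs_nonneg _)).trans (add_abs_le_predMax f i x)
  have hpow : ∀ t : ℝ, 0 ≤ t → t ^ (p - 2) * t ^ 2 = t ^ p := fun t ht => by
    rw [← Real.rpow_natCast, ← Real.rpow_add' ht (by push_cast; linarith)]
    congr 1
    push_cast; ring
  have hvi : ∀ i, Integrable (fun x => (v i x * (f (i + 1) x - f i x)) ^ 2) μ := fun i => by
    refine (h.integrable_predMax_rpow (by linarith) i).mono'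
      ((((hvm i).mono (ℱ.le i) le_rfl).mul
        ((h.measurable' (i + 1)).sub (h.measurable' i))).pow_const 2).aestronglyMeasurable
      (ae_of_all _ fun x => ?_)
    have h0 := predMax_nonneg f i x
    rw [Real.norm_of_nonneg (sq_nonneg _), mul_pow, hv2, ← hpow _ h0, ← sq_abs (f (i + 1) x - _)]
    gcongr
    exact hdw i x
  have hw := h.integrable_predMax_rpow (by linarith) k
  obtain ⟨hTi, hTe⟩ := h.integral_transform_sq hvm hvi (k + 1)
  have hpath : ∀ x, sqSum f (k + 1) x ^ (p / 2) ≤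
      ∑ i ∈ Finset.range (k + 1), (v i x * (f (i + 1) x - f i x)) ^ 2 + predMax f k x ^ p := by
    intro x
    have h0 := sqSum_nonneg f (k + 1) x
    have hsum : sqSum f (k + 1) x * predMax f k x ^ (p - 2) ≤
        ∑ i ∈ Finset.range (k + 1), (v i x * (f (i + 1) x - f i x)) ^ 2 := by
      rw [sqSum, Finset.sum_mul]
      refine Finset.sum_le_sum fun i hi => ?_
      have hik : predMax f i x ≤ predMax f k x :=
        predMax_mono f x (by have := Finset.mem_range.1 hi; omega)
      rw [mul_pow, hv2, mul_comm]
      rcases (predMax_nonneg f i x).eq_or_lt with hz | hz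
      -- Where `predMax` vanishes the negative power takes the value `0`, so monotonicity fails; the
      -- increment vanishes too, which saves the inequality.
      · have : f (i + 1) x - f i x = 0 := abs_nonpos_iff.1 (hz ▸ hdw i x)
        simp [this]
      · exact mul_le_mul_of_nonneg_right
          (Real.rpow_le_rpow_of_nonpos hz hik (by linarith)) (sq_nonneg _)
    rcases (predMax_nonneg f k x).eq_or_lt with hz | hz
    · have : sqSum f (k + 1) x = 0 := Finset.sum_eq_zero fun i hi => by
        have hik : predMax f i x ≤ predMax f k x :=
          predMax_mono f x (by have := Finset.mem_range.1 hi; omega)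
        have : f (i + 1) x - f i x = 0 := abs_nonpos_iff.1 ((hdw i x).trans (hik.trans hz.ge))
        rw [this]; norm_num
      rw [this, Real.zero_rpow (by linarith)]
      exact add_nonneg (Finset.sum_nonneg fun _ _ => sq_nonneg _)
        (Real.rpow_nonneg (predMax_nonneg f k x) _)
    · have hY := rpow_le_add_mul_rpow_sub_one (b := p / 2) (by linarith) (by linarith) h0
        (pow_pos hz 2)
      rw [← Real.rpow_natCast_mul hz.le, ← Real.rpow_natCast_mul hz.le,
        show ((2 : ℕ) : ℝ) * (p / 2) = p by push_cast; ring,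
        show ((2 : ℕ) : ℝ) * (p / 2 - 1) = p - 2 by push_cast; ring] at hY
      have h1 : 0 ≤ predMax f k x ^ p := by positivity
      have h2 : 0 ≤ sqSum f (k + 1) x * predMax f k x ^ (p - 2) := by positivity
      nlinarith
  have hmain : ∫ x, sqSum f (k + 1) x ^ (p / 2) ∂μ ≤ 10 * ∫ x, predMax f k x ^ p ∂μ := by
    calc ∫ x, sqSum f (k + 1) x ^ (p / 2) ∂μ
        ≤ ∫ x, (∑ i ∈ Finset.range (k + 1), (v i x * (f (i + 1) x - f i x)) ^ 2 +
            predMax f k x ^ p) ∂μ :=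
          integral_mono (h.integrable_sqSum_rpow hp _)
            ((integrable_finsetSum _ fun i _ => hvi i).add hw) hpath
      _ = ∫ x, transform v f (k + 1) x ^ 2 ∂μ + ∫ x, predMax f k x ^ p ∂μ := by
          rw [integral_add (integrable_finsetSum _ fun i _ => hvi i) hw, hTe]
      _ ≤ ∫ x, 9 * predMax f k x ^ p ∂μ + ∫ x, predMax f k x ^ p ∂μ := by
          refine add_le_add_left (integral_mono hTi (hw.const_mul _) fun x => ?_) _
          have hT := abs_transform_predMax_le (b := p / 2) (by linarith) (by linarith) f k x
          have hb : (p / 2)⁻¹ + 1 ≤ 3 := by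
            have : (p / 2)⁻¹ ≤ 2 := by
              rw [inv_le_comm₀ (by linarith) (by norm_num)]; linarith
            linarith
          have h0 : 0 ≤ predMax f k x ^ (p / 2) := Real.rpow_nonneg (predMax_nonneg f k x) _
          have hT' : |transform v f (k + 1) x| ≤ 3 * predMax f k x ^ (p / 2) :=
            hT.trans (by gcongr)
          calc transform v f (k + 1) x ^ 2 = |transform v f (k + 1) x| ^ 2 := (sq_abs _).symm
            _ ≤ (3 * predMax f k x ^ (p / 2)) ^ 2 := by gcongr
            _ = 9 * predMax f k x ^ p := by
              rw [mul_pow, ← Real.rpow_mul_natCast (predMax_nonneg f k x)]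
              congr 1
              · norm_num
              · congr 1
                push_cast; ring
      _ = _ := by rw [integral_const_mul]; ring
  have hle : ∫ x, predMax f k x ^ p ∂μ ≤ 9 * ∫ x, runMax f (k + 1) x ^ p ∂μ := by
    rw [← integral_const_mul]
    refine integral_mono hw ((h.integrable_runMax_rpow _).const_mul _) fun x => ?_
    have h1 := runMax_nonneg f (k + 1) x
    calc predMax f k x ^ p ≤ (3 * runMax f (k + 1) x) ^ p :=
          Real.rpow_le_rpow (predMax_nonneg f k x) (predMax_le_runMax f k x) (by linarith)
      _ = 3 ^ p * runMax f (k + 1) x ^ p := Real.mul_rpow (by norm_num) h1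
      _ ≤ 9 * runMax f (k + 1) x ^ p := by
        gcongr
        calc (3 : ℝ) ^ p ≤ 3 ^ (2 : ℝ) := Real.rpow_le_rpow_of_exponent_le (by norm_num) hp₂.le
          _ = 9 := by norm_num
  linarith

end IsRegularMartingale

/-- The square function of a regular martingale is bounded in `L^p`. -/
theorem exists_integral_sqSum_le (Ω : Type*) {m : MeasurableSpace Ω} {p : ℝ} (hp : 1 < p) :
    ∃ C : ℝ, 0 ≤ C ∧ ∀ (μ : Measure Ω) (ℱ : Filtration ℕ m) (f : ℕ → Ω → ℝ),
      IsRegularMartingale μ p ℱ f → ∀ n,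
        ∫ x, sqSum f n x ^ (p / 2) ∂μ ≤ C * ∫ x, |f n x| ^ p ∂μ := by
  have hD : 0 ≤ (2 * p / (p - 1)) ^ p := by
    have : 0 < p - 1 := by linarith
    positivity
  rcases lt_or_ge p 2 with hp2 | hp2
  · refine ⟨90 * (2 * p / (p - 1)) ^ p, by positivity, fun μ ℱ f h n => ?_⟩
    rw [mul_assoc]
    exact (h.integral_sqSum_le_of_lt_two hp hp2 n).trans
      (mul_le_mul_of_nonneg_left (h.integral_runMax_le hp n) (by norm_num))
  · refine ⟨4 * p * (4 * p) ^ ((p - 2) / 2) * (2 * p / (p - 1)) ^ p, by positivity,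
      fun μ ℱ f h n => ?_⟩
    rw [mul_assoc]
    exact (h.integral_sqSum_le_of_two_le hp2 n).trans
      (mul_le_mul_of_nonneg_left (h.integral_runMax_le hp n) (by positivity))

end RegularMartingales

/-! ### Dyadic intervals, averages, and their martingale structure. -/

section DyadicAverages

instance : SigmaFinite posVolume := by unfold posVolume; infer_instance

theorem ae_posVolume_nonneg : ∀ᵐ x ∂posVolume, (0 : ℝ) ≤ x :=
  ae_restrict_mem measurableSet_Ici

/-- The index of the dyadic interval of level `n` that contains `x ≥ 0`. -/
def dyadicIndex (n : ℤ) (x : ℝ) : ℕ := ⌊(2 : ℝ) ^ n * x⌋₊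

/-- The condition `0 ≤ x` cannot be dropped: the natural floor sends negative points to index `0`.
-/
theorem mem_dyadicInterval_iff {n : ℤ} {k : ℕ} {x : ℝ} :
    x ∈ dyadicInterval n k ↔ 0 ≤ x ∧ dyadicIndex n x = k := by
  have h2 : (0 : ℝ) < 2 ^ n := by positivity
  have key : x ∈ dyadicInterval n k ↔ (k : ℝ) ≤ 2 ^ n * x ∧ 2 ^ n * x < k + 1 := by
    rw [dyadicInterval, mem_Ico, zpow_neg, ← div_eq_mul_inv, ← div_eq_mul_inv, div_le_iff₀ h2,
      lt_div_iff₀ h2, mul_comm x]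
  constructor
  · intro h
    have h1 := key.1 h
    have hx : 0 ≤ x := by
      have : (0 : ℝ) ≤ 2 ^ n * x := (Nat.cast_nonneg k).trans h1.1
      exact nonneg_of_mul_nonneg_right this h2
    exact ⟨hx, (Nat.floor_eq_iff (by positivity)).2 h1⟩
  · rintro ⟨hx, h⟩
    exact key.2 ((Nat.floor_eq_iff (by positivity)).1 h)

theorem mem_dyadicInterval_dyadicIndex (n : ℤ) {x : ℝ} (hx : 0 ≤ x) :
    x ∈ dyadicInterval n (dyadicIndex n x) := mem_dyadicInterval_iff.2 ⟨hx, rfl⟩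

theorem dyadicIndex_eq_div (n : ℤ) (x : ℝ) : dyadicIndex n x = dyadicIndex (n + 1) x / 2 := by
  rw [dyadicIndex, dyadicIndex, ← Nat.floor_div_ofNat]
  congr 1
  rw [zpow_add_one₀ (by norm_num)]
  ring

theorem measurable_dyadicIndex (n : ℤ) : Measurable (dyadicIndex n) :=
  Nat.measurable_floor.comp (measurable_const_mul _)

theorem measurableSet_dyadicInterval (n : ℤ) (k : ℕ) : MeasurableSet (dyadicInterval n k) :=
  measurableSet_Ico

theorem dyadicInterval_subset_Ici (n : ℤ) (k : ℕ) : dyadicInterval n k ⊆ Ici 0 :=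
  fun _ hx => (mem_dyadicInterval_iff.1 hx).1

theorem posVolume_restrict_dyadicInterval (n : ℤ) (k : ℕ) :
    posVolume.restrict (dyadicInterval n k) = volume.restrict (dyadicInterval n k) := by
  rw [posVolume, Measure.restrict_restrict (measurableSet_dyadicInterval n k),
    inter_eq_left.2 (dyadicInterval_subset_Ici n k)]

theorem posVolume_dyadicInterval (n : ℤ) (k : ℕ) :
    posVolume (dyadicInterval n k) = ENNReal.ofReal (2 ^ (-n)) := by
  rw [posVolume, Measure.restrict_apply (measurableSet_dyadicInterval n k),
    inter_eq_left.2 (dyadicInterval_subset_Ici n k), ← volume_real_dyadicInterval n k,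
    ofReal_measureReal (by simp [dyadicInterval])]

theorem iUnion_dyadicInterval (n : ℤ) : ⋃ k, dyadicInterval n k = Ici (0 : ℝ) := by
  ext x
  simp [mem_dyadicInterval_iff]

theorem pairwise_disjoint_dyadicInterval (n : ℤ) :
    Pairwise (Function.onFun Disjoint (dyadicInterval n)) := fun i j hij => by
  refine Set.disjoint_left.2 fun x hi hj => hij ?_
  rw [← (mem_dyadicInterval_iff.1 hi).2, (mem_dyadicInterval_iff.1 hj).2]

theorem dyadicInterval_eq_union (n : ℤ) (k : ℕ) : dyadicInterval n k =
    dyadicInterval (n + 1) (2 * k) ∪ dyadicInterval (n + 1) (2 * k + 1) := by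
  ext x
  simp only [mem_union, mem_dyadicInterval_iff, dyadicIndex_eq_div n x, ← and_or_left]
  refine and_congr_right fun _ => ?_
  omega

theorem disjoint_dyadicInterval_children (n : ℤ) (k : ℕ) :
    Disjoint (dyadicInterval (n + 1) (2 * k)) (dyadicInterval (n + 1) (2 * k + 1)) :=
  pairwise_disjoint_dyadicInterval (n + 1) (by omega)

/-- A function on `ℝ⁺` that is integrable on every dyadic interval. -/
def DyadicIntegrable (f : ℝ → ℝ) : Prop :=
  ∀ n k, IntegrableOn f (dyadicInterval n k) posVolume

theorem _root_.MeasureTheory.MemLp.dyadicIntegrable {f : ℝ → ℝ} {p : ℝ≥0∞} (hp : 1 ≤ p)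
    (hf : MemLp f p posVolume) : DyadicIntegrable f := fun n k => by
  have : IsFiniteMeasure (posVolume.restrict (dyadicInterval n k)) :=
    ⟨by rw [Measure.restrict_apply_univ, posVolume_dyadicInterval]; exact ENNReal.ofReal_lt_top⟩
  exact (hf.restrict _).integrable hp

theorem DyadicIntegrable.setIntegral_eq_add {f : ℝ → ℝ} (hf : DyadicIntegrable f) (n : ℤ)
    (k : ℕ) : ∫ y in dyadicInterval n k, f y ∂posVolume =
      ∫ y in dyadicInterval (n + 1) (2 * k), f y ∂posVolume +
        ∫ y in dyadicInterval (n + 1) (2 * k + 1), f y ∂posVolume := by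
  rw [dyadicInterval_eq_union, setIntegral_union (disjoint_dyadicInterval_children n k)
    (measurableSet_dyadicInterval _ _) (hf _ _) (hf _ _)]

theorem integral_eq_zero_of_dyadicInterval {g : ℝ → ℝ} (n : ℤ) (hg : Integrable g posVolume)
    (h : ∀ k, ∫ y in dyadicInterval n k, g y ∂posVolume = 0) : ∫ y, g y ∂posVolume = 0 := by
  have h1 : posVolume = posVolume.restrict (⋃ k, dyadicInterval n k) := by
    rw [iUnion_dyadicInterval, posVolume, Measure.restrict_restrict measurableSet_Ici, inter_self]
  rw [h1, integral_iUnion (measurableSet_dyadicInterval n) (pairwise_disjoint_dyadicInterval n)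
    hg.integrableOn]
  simp [h]

/-- The conditional expectation of `f` with respect to the dyadic intervals of level `n`. -/
def dyadicAvg (n : ℤ) (f : ℝ → ℝ) (x : ℝ) : ℝ :=
  2 ^ n * ∫ y in dyadicInterval n (dyadicIndex n x), f y ∂posVolume

/-- The difference of two consecutive dyadic averages. -/
def dyadicDiff (n : ℤ) (f : ℝ → ℝ) (x : ℝ) : ℝ := dyadicAvg (n + 1) f x - dyadicAvg n f x

/-- Half the difference of the averages of `f` over the two halves of a dyadic interval. -/
def halfDiff (f : ℝ → ℝ) (n : ℤ) (k : ℕ) : ℝ :=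
  2 ^ n * (∫ y in dyadicInterval (n + 1) (2 * k), f y ∂posVolume -
    ∫ y in dyadicInterval (n + 1) (2 * k + 1), f y ∂posVolume)

theorem dyadicDiff_eq {f : ℝ → ℝ} (hf : DyadicIntegrable f) (n : ℤ) (x : ℝ) :
    dyadicDiff n f x = (if dyadicIndex (n + 1) x % 2 = 0 then 1 else -1) *
      halfDiff f n (dyadicIndex n x) := by
  have h2 : (2 : ℝ) ^ (n + 1) = 2 ^ n * 2 := zpow_add_one₀ (by norm_num) n
  rw [dyadicDiff, dyadicAvg, dyadicAvg, hf.setIntegral_eq_add n, halfDiff, h2]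
  have hi := dyadicIndex_eq_div n x
  split_ifs with h
  · have : dyadicIndex (n + 1) x = 2 * dyadicIndex n x := by omega
    rw [this]; ring
  · have : dyadicIndex (n + 1) x = 2 * dyadicIndex n x + 1 := by omega
    rw [this]; ring

/-- The two halves of an interval carry opposite values of the difference, so its absolute value
depends only on the parent. This is the predictability required of a regular martingale. -/
theorem abs_dyadicDiff {f : ℝ → ℝ} (hf : DyadicIntegrable f) (n : ℤ) (x : ℝ) :
    |dyadicDiff n f x| = |halfDiff f n (dyadicIndex n x)| := by
  rw [dyadicDiff_eq hf]
  split_ifs <;> simp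

theorem measurable_comp_dyadicIndex {β : Type*} [MeasurableSpace β] (c : ℕ → β) (n : ℤ) :
    Measurable[MeasurableSpace.comap (dyadicIndex n) ⊤] (fun x => c (dyadicIndex n x)) :=
  measurable_from_top.comp (comap_measurable (dyadicIndex n))

theorem comap_dyadicIndex_le (n : ℤ) :
    MeasurableSpace.comap (dyadicIndex n) ⊤ ≤ (inferInstance : MeasurableSpace ℝ) :=
  (measurable_dyadicIndex n).comap_le

theorem comap_dyadicIndex_mono_succ (n : ℤ) : MeasurableSpace.comap (dyadicIndex n) ⊤ ≤
    MeasurableSpace.comap (dyadicIndex (n + 1)) ⊤ := by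
  have h := measurable_comp_dyadicIndex (fun k => k / 2) (n + 1)
  simp only [← dyadicIndex_eq_div] at h
  exact h.comap_le

/-- The filtration of the dyadic intervals of levels `a, a + 1, …`. -/
def dyadicFiltration (a : ℤ) : Filtration ℕ (inferInstance : MeasurableSpace ℝ) where
  seq n := MeasurableSpace.comap (dyadicIndex (a + n)) ⊤
  mono' := monotone_nat_of_le_succ fun n => by
    have := comap_dyadicIndex_mono_succ (a + n)
    rwa [add_assoc] at this
  le' n := comap_dyadicIndex_le _

theorem measurable_dyadicAvg_comap (n : ℤ) (f : ℝ → ℝ) :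
    Measurable[MeasurableSpace.comap (dyadicIndex n) ⊤] (dyadicAvg n f) :=
  measurable_comp_dyadicIndex
    (fun k => 2 ^ n * ∫ y in dyadicInterval n k, f y ∂posVolume) n

theorem measurable_dyadicAvg (n : ℤ) (f : ℝ → ℝ) : Measurable (dyadicAvg n f) :=
  (measurable_dyadicAvg_comap n f).mono (comap_dyadicIndex_le n) le_rfl

theorem measurable_dyadicDiff (n : ℤ) (f : ℝ → ℝ) : Measurable (dyadicDiff n f) :=
  (measurable_dyadicAvg _ f).sub (measurable_dyadicAvg _ f)

theorem setIntegral_dyadicAvg (f : ℝ → ℝ) (n : ℤ) (k : ℕ) :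
    ∫ y in dyadicInterval n k, dyadicAvg n f y ∂posVolume =
      ∫ y in dyadicInterval n k, f y ∂posVolume := by
  have h : EqOn (dyadicAvg n f)
      (fun _ => 2 ^ n * ∫ y in dyadicInterval n k, f y ∂posVolume) (dyadicInterval n k) :=
    fun x hx => by simp only [dyadicAvg, (mem_dyadicInterval_iff.1 hx).2]
  rw [setIntegral_congr_fun (measurableSet_dyadicInterval n k) h, setIntegral_const,
    measureReal_def, posVolume_dyadicInterval, ENNReal.toReal_ofReal (by positivity), smul_eq_mul,
    ← mul_assoc, ← zpow_add₀ (by norm_num)]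
  simp

theorem integrableOn_dyadicAvg (f : ℝ → ℝ) (n : ℤ) (k : ℕ) :
    IntegrableOn (dyadicAvg n f) (dyadicInterval n k) posVolume := by
  have h : EqOn (dyadicAvg n f)
      (fun _ => 2 ^ n * ∫ y in dyadicInterval n k, f y ∂posVolume) (dyadicInterval n k) :=
    fun x hx => by simp only [dyadicAvg, (mem_dyadicInterval_iff.1 hx).2]
  rw [integrableOn_congr_fun h (measurableSet_dyadicInterval n k)]
  refine integrableOn_const ?_
  rw [posVolume_dyadicInterval]
  exact ENNReal.ofReal_ne_top

theorem integrableOn_dyadicAvg_succ (f : ℝ → ℝ) (n : ℤ) (k : ℕ) :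
    IntegrableOn (dyadicAvg (n + 1) f) (dyadicInterval n k) posVolume := by
  rw [dyadicInterval_eq_union]
  exact (integrableOn_dyadicAvg f _ _).union (integrableOn_dyadicAvg f _ _)

theorem setIntegral_dyadicAvg_succ {f : ℝ → ℝ} (hf : DyadicIntegrable f) (n : ℤ) (k : ℕ) :
    ∫ y in dyadicInterval n k, dyadicAvg (n + 1) f y ∂posVolume =
      ∫ y in dyadicInterval n k, f y ∂posVolume := by
  rw [hf.setIntegral_eq_add, dyadicInterval_eq_union,
    setIntegral_union (disjoint_dyadicInterval_children n k) (measurableSet_dyadicInterval _ _)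
      (integrableOn_dyadicAvg f _ _) (integrableOn_dyadicAvg f _ _),
    setIntegral_dyadicAvg, setIntegral_dyadicAvg]

/-- Measurability for the pullback of the discrete σ-algebra forces `u` to factor through
`dyadicIndex n`, so `u` is constant on the interval. -/
theorem setIntegral_mul_of_comap {u g : ℝ → ℝ} {n : ℤ}
    (hu : Measurable[MeasurableSpace.comap (dyadicIndex n) ⊤] u) {k : ℕ}
    (hg : ∫ y in dyadicInterval n k, g y ∂posVolume = 0) :
    ∫ y in dyadicInterval n k, u y * g y ∂posVolume = 0 := by
  have hfac := hu.factorsThrough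
  rcases (dyadicInterval n k).eq_empty_or_nonempty with he | ⟨x, hx⟩
  · simp [he]
  have h : EqOn (fun y => u y * g y) (fun y => u x * g y) (dyadicInterval n k) := fun y hy => by
    have : u y = u x := hfac (by
      rw [(mem_dyadicInterval_iff.1 hx).2, (mem_dyadicInterval_iff.1 hy).2])
    simp only [this]
  rw [setIntegral_congr_fun (measurableSet_dyadicInterval n k) h, integral_const_mul, hg, mul_zero]

/-- Dyadic differences of level `n` are orthogonal to functions of level `n`. -/
theorem integral_mul_dyadicDiff_eq_zero {f u : ℝ → ℝ} (hf : DyadicIntegrable f) {n : ℤ}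
    (hu : Measurable[MeasurableSpace.comap (dyadicIndex n) ⊤] u)
    (hi : Integrable (fun x => u x * dyadicDiff n f x) posVolume) :
    ∫ x, u x * dyadicDiff n f x ∂posVolume = 0 :=
  integral_eq_zero_of_dyadicInterval n hi fun k => setIntegral_mul_of_comap hu <| by
    simp only [dyadicDiff]
    rw [integral_sub (integrableOn_dyadicAvg_succ f n k) (integrableOn_dyadicAvg f n k),
      setIntegral_dyadicAvg_succ hf, setIntegral_dyadicAvg, sub_self]

theorem integral_mul_sub_dyadicAvg_eq_zero {f u : ℝ → ℝ} (hf : DyadicIntegrable f) {n : ℤ}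
    (hu : Measurable[MeasurableSpace.comap (dyadicIndex n) ⊤] u)
    (hi : Integrable (fun x => u x * (f x - dyadicAvg n f x)) posVolume) :
    ∫ x, u x * (f x - dyadicAvg n f x) ∂posVolume = 0 :=
  integral_eq_zero_of_dyadicInterval n hi fun k => setIntegral_mul_of_comap hu <| by
    rw [integral_sub (hf n k) (integrableOn_dyadicAvg f n k),
      setIntegral_dyadicAvg, sub_self]

/-! ### Schur's test and contractivity of dyadic averages. -/

/-- Schur's test for a doubly substochastic kernel. -/
theorem lintegral_rpow_lintegral_kernel_le_of_measurable {p : ℝ} (hp : 1 < p)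
    {μ : Measure ℝ} [SFinite μ] {k : ℝ → ℝ → ℝ≥0∞} (hk : Measurable (Function.uncurry k))
    (h₁ : ∀ᵐ x ∂μ, ∫⁻ y, k x y ∂μ ≤ 1) (h₂ : ∀ᵐ y ∂μ, ∫⁻ x, k x y ∂μ ≤ 1) {g : ℝ → ℝ≥0∞}
    (hg : Measurable g) :
    ∫⁻ x, (∫⁻ y, k x y * g y ∂μ) ^ p ∂μ ≤ ∫⁻ y, g y ^ p ∂μ := by
  have hconj : p.HolderConjugate (p / (p - 1)) := Real.HolderConjugate.conjExponent hp
  set q := p / (p - 1)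
  have hp0 : 0 < p := by linarith
  have hq0 : 0 < q := hconj.symm.pos
  have hkx : ∀ x, Measurable (k x) := fun x => hk.comp measurable_prodMk_left
  -- Hölder applied to the splitting `k = k^{1/p} k^{1/q}`; the factor `(∫ k)^{1/q}` is at most `1`.
  have hpt : ∀ᵐ x ∂μ, (∫⁻ y, k x y * g y ∂μ) ^ p ≤ ∫⁻ y, k x y * g y ^ p ∂μ := by
    filter_upwards [h₁] with x hx
    have hH := ENNReal.lintegral_mul_le_Lp_mul_Lq μ hconj
      (((hkx x).pow_const (1 / p)).mul hg).aemeasurable ((hkx x).pow_const (1 / q)).aemeasurable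
    have e1 : ∀ y, (((fun y => k x y ^ (1 / p)) * g) * fun y => k x y ^ (1 / q)) y =
        k x y * g y := fun y => by
      have : k x y ^ (1 / p) * k x y ^ (1 / q) = k x y := by
        rw [← ENNReal.rpow_add_of_nonneg _ _ (by positivity) (by positivity), one_div, one_div,
          hconj.inv_add_inv_eq_one, ENNReal.rpow_one]
      simp only [Pi.mul_apply]
      rw [mul_right_comm, this]
    have e2 : ∀ y, ((fun y => k x y ^ (1 / p)) * g) y ^ p = k x y * g y ^ p := fun y => by
      simp only [Pi.mul_apply]
      rw [ENNReal.mul_rpow_of_nonneg _ _ hp0.le, ← ENNReal.rpow_mul, one_div,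
        inv_mul_cancel₀ hp0.ne', ENNReal.rpow_one]
    have e3 : ∀ y, (k x y ^ (1 / q)) ^ q = k x y := fun y => by
      rw [← ENNReal.rpow_mul, one_div, inv_mul_cancel₀ hq0.ne', ENNReal.rpow_one]
    have hH' : ∫⁻ y, k x y * g y ∂μ ≤
        (∫⁻ y, k x y * g y ^ p ∂μ) ^ (1 / p) * (∫⁻ y, k x y ∂μ) ^ (1 / q) := by
      simpa only [← e1, ← e2, e3] using hH
    calc (∫⁻ y, k x y * g y ∂μ) ^ p
        ≤ ((∫⁻ y, k x y * g y ^ p ∂μ) ^ (1 / p) * 1) ^ p := by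
          gcongr
          refine hH'.trans ?_
          gcongr
          exact ENNReal.rpow_le_one hx (by positivity)
      _ = _ := by
        rw [mul_one, ← ENNReal.rpow_mul, one_div, inv_mul_cancel₀ hp0.ne', ENNReal.rpow_one]
  calc ∫⁻ x, (∫⁻ y, k x y * g y ∂μ) ^ p ∂μ
      ≤ ∫⁻ x, ∫⁻ y, k x y * g y ^ p ∂μ ∂μ := lintegral_mono_ae hpt
    _ = ∫⁻ y, ∫⁻ x, k x y * g y ^ p ∂μ ∂μ :=
        lintegral_lintegral_swap
          (hk.mul ((hg.pow_const p).comp measurable_snd)).aemeasurable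
    _ ≤ ∫⁻ y, g y ^ p ∂μ := by
        refine lintegral_mono_ae ?_
        filter_upwards [h₂] with y hy
        have hky : Measurable fun x => k x y := hk.comp measurable_prodMk_right
        rw [lintegral_mul_const _ hky]
        exact mul_le_of_le_one_left zero_le hy

theorem lintegral_rpow_lintegral_kernel_le {p : ℝ} (hp : 1 < p) {μ : Measure ℝ} [SFinite μ]
    {k : ℝ → ℝ → ℝ≥0∞} (hk : Measurable (Function.uncurry k))
    (h₁ : ∀ᵐ x ∂μ, ∫⁻ y, k x y ∂μ ≤ 1) (h₂ : ∀ᵐ y ∂μ, ∫⁻ x, k x y ∂μ ≤ 1) {g : ℝ → ℝ≥0∞}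
    (hg : AEMeasurable g μ) :
    ∫⁻ x, (∫⁻ y, k x y * g y ∂μ) ^ p ∂μ ≤ ∫⁻ y, g y ^ p ∂μ := by
  have h := lintegral_rpow_lintegral_kernel_le_of_measurable hp hk h₁ h₂ hg.measurable_mk
  have e1 : ∀ x, ∫⁻ y, k x y * hg.mk g y ∂μ = ∫⁻ y, k x y * g y ∂μ := fun x =>
    lintegral_congr_ae (by filter_upwards [hg.ae_eq_mk] with y hy; rw [hy])
  have e2 : ∫⁻ y, hg.mk g y ^ p ∂μ = ∫⁻ y, g y ^ p ∂μ :=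
    lintegral_congr_ae (by filter_upwards [hg.ae_eq_mk] with y hy; rw [hy])
  simpa only [e1, e2] using h

theorem ae_dyadicIndex_eq_iff (n : ℤ) (k : ℕ) :
    ({y | dyadicIndex n y = k} : Set ℝ) =ᵐ[posVolume] dyadicInterval n k := by
  filter_upwards [ae_posVolume_nonneg] with y hy
  exact propext ⟨fun h => mem_dyadicInterval_iff.2 ⟨hy, h⟩, fun h => (mem_dyadicInterval_iff.1 h).2⟩

theorem measurableSet_dyadicIndex_eq (n : ℤ) (k : ℕ) :
    MeasurableSet {y : ℝ | dyadicIndex n y = k} :=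
  measurable_dyadicIndex n (measurableSet_singleton k)

/-- Dyadic averages contract the `L^p` norm. -/
theorem lintegral_enorm_dyadicAvg_rpow_le {p : ℝ} (hp : 1 < p) {f : ℝ → ℝ}
    (hf : AEStronglyMeasurable f posVolume) (n : ℤ) :
    ∫⁻ x, ‖dyadicAvg n f x‖ₑ ^ p ∂posVolume ≤ ∫⁻ x, ‖f x‖ₑ ^ p ∂posVolume := by
  -- Averaging is integration against `2^n` on pairs with equal level-`n` index, a symmetric kernel
  -- with unit row integrals.
  set k : ℝ → ℝ → ℝ≥0∞ := fun x y =>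
    {z : ℝ × ℝ | dyadicIndex n z.2 = dyadicIndex n z.1}.indicator
      (fun _ => ENNReal.ofReal (2 ^ n)) (x, y) with hkdef
  have hk : Measurable (Function.uncurry k) :=
    measurable_const.indicator (measurableSet_eq_fun
      ((measurable_dyadicIndex n).comp measurable_snd)
      ((measurable_dyadicIndex n).comp measurable_fst))
  have hone : ENNReal.ofReal (2 ^ n) * ENNReal.ofReal (2 ^ (-n)) = 1 := by
    rw [← ENNReal.ofReal_mul (by positivity), ← zpow_add₀ (by norm_num)]
    simp
  have hrow : ∀ x, k x = {y | dyadicIndex n y = dyadicIndex n x}.indicator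
      (fun _ => ENNReal.ofReal (2 ^ n)) := fun x => rfl
  have hcol : ∀ y, (fun x => k x y) = k y := fun y => by
    funext x
    simp only [hkdef, indicator, mem_ofPred_eq, eq_comm]
  have h₁ : ∀ x, ∫⁻ y, k x y ∂posVolume ≤ 1 := fun x => by
    rw [hrow, lintegral_indicator (measurableSet_dyadicIndex_eq _ _), setLIntegral_const,
      measure_congr (ae_dyadicIndex_eq_iff n _), posVolume_dyadicInterval, hone]
  have h₂ : ∀ y, ∫⁻ x, k x y ∂posVolume ≤ 1 := fun y => by
    rw [hcol]; exact h₁ y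
  refine le_trans (lintegral_mono fun x => ?_) (lintegral_rpow_lintegral_kernel_le hp hk
    (ae_of_all _ h₁) (ae_of_all _ h₂) hf.enorm)
  refine ENNReal.rpow_le_rpow ?_ (by linarith)
  rw [dyadicAvg, enorm_mul, Real.enorm_of_nonneg (by positivity)]
  have : ∫⁻ y, k x y * ‖f y‖ₑ ∂posVolume = ENNReal.ofReal (2 ^ n) *
      ∫⁻ y in dyadicInterval n (dyadicIndex n x), ‖f y‖ₑ ∂posVolume := by
    rw [← lintegral_const_mul' _ _ ENNReal.ofReal_ne_top,
      ← setLIntegral_congr (ae_dyadicIndex_eq_iff n _),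
      ← lintegral_indicator (measurableSet_dyadicIndex_eq _ _)]
    refine lintegral_congr fun y => ?_
    rw [hrow]
    by_cases h : dyadicIndex n y = dyadicIndex n x <;> simp [indicator, h]
  rw [this]
  gcongr
  exact enorm_integral_le_lintegral_enorm _

theorem eLpNorm_dyadicAvg_le {p : ℝ≥0∞} (hp₁ : 1 < p) (hp₂ : p < ∞) {f : ℝ → ℝ}
    (hf : AEStronglyMeasurable f posVolume) (n : ℤ) :
    eLpNorm (dyadicAvg n f) p posVolume ≤ eLpNorm f p posVolume := by
  have hp0 : p ≠ 0 := (zero_lt_one.trans hp₁).ne'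
  have hp1 : 1 < p.toReal := by
    simpa using (ENNReal.toReal_lt_toReal ENNReal.one_ne_top hp₂.ne).2 hp₁
  rw [eLpNorm_eq_lintegral_rpow_enorm_toReal hp0 hp₂.ne,
    eLpNorm_eq_lintegral_rpow_enorm_toReal hp0 hp₂.ne]
  exact ENNReal.rpow_le_rpow (lintegral_enorm_dyadicAvg_rpow_le hp1 hf n) (by positivity)

theorem memLp_dyadicAvg {p : ℝ≥0∞} (hp₁ : 1 < p) (hp₂ : p < ∞) {f : ℝ → ℝ}
    (hf : MemLp f p posVolume) (n : ℤ) : MemLp (dyadicAvg n f) p posVolume :=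
  ⟨(measurable_dyadicAvg n f).aestronglyMeasurable,
    (eLpNorm_dyadicAvg_le hp₁ hp₂ hf.1 n).trans_lt hf.2⟩

theorem memLp_dyadicDiff {p : ℝ≥0∞} (hp₁ : 1 < p) (hp₂ : p < ∞) {f : ℝ → ℝ}
    (hf : MemLp f p posVolume) (n : ℤ) : MemLp (dyadicDiff n f) p posVolume :=
  (memLp_dyadicAvg hp₁ hp₂ hf (n + 1)).sub (memLp_dyadicAvg hp₁ hp₂ hf n)

/-- The dyadic averages of an `L^p` function form a regular martingale. -/
theorem isRegularMartingale_dyadicAvg {p : ℝ≥0∞} (hp₁ : 1 < p) (hp₂ : p < ∞) {f : ℝ → ℝ}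
    (hf : MemLp f p posVolume) (a : ℤ) :
    IsRegularMartingale posVolume p.toReal (dyadicFiltration a)
      (fun i => dyadicAvg (a + i) f) := by
  have hloc := hf.dyadicIntegrable hp₁.le
  have hd : ∀ (n : ℕ) (x : ℝ), dyadicAvg (a + (n + 1 : ℕ)) f x - dyadicAvg (a + n) f x =
      dyadicDiff (a + n) f x := fun n x => by
    rw [dyadicDiff]; push_cast; rw [add_assoc]
  refine ⟨fun n => measurable_dyadicAvg_comap _ f, fun n => ?_, fun n => ?_, fun n u hu hi => ?_⟩
  · simp only [hd, abs_dyadicDiff hloc]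
    exact measurable_comp_dyadicIndex (fun k => |halfDiff f (a + n) k|) _
  · exact (memLp_dyadicAvg hp₁ hp₂ hf (a + n)).integrable_norm_rpow
      (zero_lt_one.trans hp₁).ne' hp₂.ne
  · simp only [hd] at hi ⊢
    exact integral_mul_dyadicDiff_eq_zero hloc hu hi

end DyadicAverages

/-! ### Littlewood–Paley equivalence for the dyadic square function. -/

section SquareFunction

open Filter Topology

/-- The dyadic square function. -/
def dyadicSquare (f : ℝ → ℝ) (x : ℝ) : ℝ≥0∞ :=
  (∑' j : ℤ, ENNReal.ofReal (dyadicDiff j f x ^ 2)) ^ (1 / 2 : ℝ)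

theorem sum_range_eq_sum_Ico_neg {M : Type*} [AddCommMonoid M] (F : ℤ → M) (N : ℕ) :
    ∑ i ∈ Finset.range (2 * N), F (-N + i) = ∑ j ∈ Finset.Ico (-N : ℤ) N, F j := by
  refine Finset.sum_bij (fun i _ => -(N : ℤ) + i) ?_ ?_ ?_ fun _ _ => rfl
  · intro i hi
    have := Finset.mem_range.1 hi
    exact Finset.mem_Ico.2 ⟨by omega, by omega⟩
  · intro i _ j _ h
    have : -(N : ℤ) + i = -N + j := h
    omega
  · intro j hj
    have := Finset.mem_Ico.1 hj
    refine ⟨(j + N).toNat, Finset.mem_range.2 (by omega), ?_⟩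
    omega

theorem tendsto_sum_range_tsum (F : ℤ → ℝ≥0∞) :
    Tendsto (fun N : ℕ => ∑ i ∈ Finset.range (2 * N), F (-N + i)) atTop (𝓝 (∑' j, F j)) := by
  simp only [sum_range_eq_sum_Ico_neg]
  exact ENNReal.summable.hasSum.comp (Finset.tendsto_Ico_neg (R := ℤ))

theorem one_lt_toReal {p : ℝ≥0∞} (hp₁ : 1 < p) (hp₂ : p < ∞) : 1 < p.toReal := by
  simpa using (ENNReal.toReal_lt_toReal ENNReal.one_ne_top hp₂.ne).2 hp₁

theorem measurable_dyadicSquare (f : ℝ → ℝ) : Measurable (dyadicSquare f) :=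
  (Measurable.tsum fun j =>
    ((measurable_dyadicDiff j f).pow_const 2).ennreal_ofReal).pow_const _

/-- Start the martingale at level `-N` and run it for `2 * N` steps. The martingale constant does
not depend on `N` and the terminal average is an `L^p` contraction of `f`, so Fatou passes to all
levels. -/
theorem exists_lintegral_dyadicSquare_le {p : ℝ≥0∞} (hp₁ : 1 < p) (hp₂ : p < ∞) :
    ∃ C : ℝ≥0, ∀ f : ℝ → ℝ, MemLp f p posVolume →
      ∫⁻ x, dyadicSquare f x ^ p.toReal ∂posVolume ≤
        C * ∫⁻ x, ‖f x‖ₑ ^ p.toReal ∂posVolume := by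
  have hp := one_lt_toReal hp₁ hp₂
  have hp0 : 0 < p.toReal := by linarith
  obtain ⟨C, hC0, hC⟩ := exists_integral_sqSum_le ℝ hp
  refine ⟨C.toNNReal, fun f hf => ?_⟩
  have hpart : ∀ N : ℕ, ∫⁻ x, (∑ i ∈ Finset.range (2 * N),
      ENNReal.ofReal (dyadicDiff (-N + i) f x ^ 2)) ^ (p.toReal / 2) ∂posVolume ≤
      C.toNNReal * ∫⁻ x, ‖f x‖ₑ ^ p.toReal ∂posVolume := by
    intro N
    have hM := isRegularMartingale_dyadicAvg hp₁ hp₂ hf (-N)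
    have h1 := hC _ _ _ hM (2 * N)
    have e1 : ∀ x, (∑ i ∈ Finset.range (2 * N),
        ENNReal.ofReal (dyadicDiff (-N + i) f x ^ 2)) ^ (p.toReal / 2) =
        ENNReal.ofReal
          (sqSum (fun i : ℕ => dyadicAvg (-N + i) f) (2 * N) x ^ (p.toReal / 2)) := by
      intro x
      rw [← ENNReal.ofReal_rpow_of_nonneg (sqSum_nonneg _ _ _) (by positivity),
        ← ENNReal.ofReal_sum_of_nonneg fun _ _ => sq_nonneg _, sqSum]
      congr 2
      refine Finset.sum_congr rfl fun i _ => ?_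
      rw [dyadicDiff]; push_cast; rw [add_assoc]
    have e2 : ∀ x, ‖dyadicAvg (-N + (2 * N : ℕ)) f x‖ₑ ^ p.toReal =
        ENNReal.ofReal (|dyadicAvg (-N + (2 * N : ℕ)) f x| ^ p.toReal) := fun x => by
      rw [← ENNReal.ofReal_rpow_of_nonneg (abs_nonneg _) (by positivity),
        Real.enorm_eq_ofReal_abs]
    simp only [e1]
    rw [← ofReal_integral_eq_lintegral_ofReal (hM.integrable_sqSum_rpow hp _)
      (ae_of_all _ fun x => Real.rpow_nonneg (sqSum_nonneg _ _ _) _)]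
    refine (ENNReal.ofReal_le_ofReal h1).trans ?_
    rw [ENNReal.ofReal_mul hC0, ofReal_integral_eq_lintegral_ofReal (hM.integrable _)
      (ae_of_all _ fun x => Real.rpow_nonneg (abs_nonneg _) _)]
    simp only [← e2]
    exact mul_le_mul_right (lintegral_enorm_dyadicAvg_rpow_le hp hf.1 _) _
  have hlim : ∀ x, dyadicSquare f x ^ p.toReal = liminf (fun N : ℕ =>
      (∑ i ∈ Finset.range (2 * N), ENNReal.ofReal (dyadicDiff (-N + i) f x ^ 2)) ^
        (p.toReal / 2)) atTop := fun x => by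
    have h1 := (tendsto_sum_range_tsum fun j => ENNReal.ofReal (dyadicDiff j f x ^ 2))
    have h2 := ((ENNReal.continuous_rpow_const (y := p.toReal / 2)).tendsto _).comp h1
    have h3 := h2.liminf_eq
    simp only [Function.comp_def] at h3
    rw [h3, dyadicSquare, ← ENNReal.rpow_mul]
    congr 1
    ring
  calc ∫⁻ x, dyadicSquare f x ^ p.toReal ∂posVolume
      = ∫⁻ x, liminf (fun N : ℕ => (∑ i ∈ Finset.range (2 * N),
          ENNReal.ofReal (dyadicDiff (-N + i) f x ^ 2)) ^ (p.toReal / 2)) atTop ∂posVolume :=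
        lintegral_congr hlim
    _ ≤ liminf (fun N : ℕ => ∫⁻ x, (∑ i ∈ Finset.range (2 * N),
          ENNReal.ofReal (dyadicDiff (-N + i) f x ^ 2)) ^ (p.toReal / 2) ∂posVolume) atTop :=
        lintegral_liminf_le fun N => (Finset.measurable_fun_sum _ fun i _ =>
          ((measurable_dyadicDiff _ f).pow_const 2).ennreal_ofReal).pow_const _
    _ ≤ _ := liminf_le_of_le (by isBoundedDefault) fun b hb => by
        obtain ⟨N, hN⟩ := hb.exists
        exact hN.trans (hpart N)

theorem eLpNorm_dyadicSquare_eq {p : ℝ≥0∞} (hp₁ : 1 < p) (hp₂ : p < ∞) (f : ℝ → ℝ) :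
    eLpNorm (dyadicSquare f) p posVolume =
      (∫⁻ x, dyadicSquare f x ^ p.toReal ∂posVolume) ^ (1 / p.toReal) := by
  rw [eLpNorm_eq_lintegral_rpow_enorm_toReal (zero_lt_one.trans hp₁).ne' hp₂.ne]
  simp only [enorm_eq_self]

/-- The dyadic square function is bounded on `L^p`. -/
theorem exists_eLpNorm_dyadicSquare_le {p : ℝ≥0∞} (hp₁ : 1 < p) (hp₂ : p < ∞) :
    ∃ C : ℝ≥0, ∀ f : ℝ → ℝ, MemLp f p posVolume →
      eLpNorm (dyadicSquare f) p posVolume ≤ C * eLpNorm f p posVolume := by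
  obtain ⟨C, hC⟩ := exists_lintegral_dyadicSquare_le hp₁ hp₂
  have hp := one_lt_toReal hp₁ hp₂
  have hp0 : 0 ≤ 1 / p.toReal := by positivity
  refine ⟨C ^ (1 / p.toReal), fun f hf => ?_⟩
  rw [eLpNorm_dyadicSquare_eq hp₁ hp₂, eLpNorm_eq_lintegral_rpow_enorm_toReal
    (zero_lt_one.trans hp₁).ne' hp₂.ne, ENNReal.coe_rpow_of_nonneg _ hp0,
    ← ENNReal.mul_rpow_of_nonneg _ _ hp0]
  exact ENNReal.rpow_le_rpow (hC f hf) hp0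

/-- Dyadic averages tend to zero as the level tends to `-∞`. -/
theorem tendsto_dyadicAvg_neg {p : ℝ≥0∞} (hp₁ : 1 < p) (hp₂ : p < ∞) {f : ℝ → ℝ}
    (hf : MemLp f p posVolume) (x : ℝ) :
    Tendsto (fun N : ℕ => dyadicAvg (-N) f x) atTop (𝓝 0) := by
  have hp := one_lt_toReal hp₁ hp₂
  have hp0 : 0 < p.toReal := by linarith
  set A := ∫⁻ y, ‖f y‖ₑ ^ p.toReal ∂posVolume with hA
  have hAfin : A ≠ ∞ :=
    (lintegral_rpow_enorm_lt_top_of_eLpNorm_lt_top (zero_lt_one.trans hp₁).ne' hp₂.ne hf.2).ne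
  have hbound : ∀ N : ℕ, ‖dyadicAvg (-N) f x‖ₑ ≤
      (ENNReal.ofReal (2⁻¹ ^ N) * A) ^ (1 / p.toReal) := fun N => by
    -- The average is constant on an interval of length `2^N`, so the `L^p` bound forces decay like
    -- `2^{-N/p}`.
    have h1 : ‖dyadicAvg (-N) f x‖ₑ ^ p.toReal * ENNReal.ofReal (2 ^ (N : ℤ)) ≤ A := by
      refine le_trans ?_ (lintegral_enorm_dyadicAvg_rpow_le hp hf.1 (-N))
      refine le_trans (le_of_eq ?_)
        (setLIntegral_le_lintegral (dyadicInterval (-N) (dyadicIndex (-N) x)) _)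
      have h : EqOn (fun y => ‖dyadicAvg (-N) f y‖ₑ ^ p.toReal)
          (fun _ => ‖dyadicAvg (-N) f x‖ₑ ^ p.toReal) (dyadicInterval (-N) (dyadicIndex (-N) x)) :=
        fun y hy => by simp only [dyadicAvg, (mem_dyadicInterval_iff.1 hy).2]
      rw [setLIntegral_congr_fun (measurableSet_dyadicInterval _ _) h, setLIntegral_const,
        posVolume_dyadicInterval, neg_neg]
    have h2 : ‖dyadicAvg (-N) f x‖ₑ ^ p.toReal ≤ ENNReal.ofReal (2⁻¹ ^ N) * A := by
      calc ‖dyadicAvg (-N) f x‖ₑ ^ p.toReal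
          = ENNReal.ofReal (2⁻¹ ^ N) *
            (‖dyadicAvg (-N) f x‖ₑ ^ p.toReal * ENNReal.ofReal (2 ^ (N : ℤ))) := by
            rw [mul_left_comm, ← ENNReal.ofReal_mul (by positivity), zpow_natCast, ← mul_pow]
            norm_num
        _ ≤ _ := by gcongr
    calc ‖dyadicAvg (-N) f x‖ₑ = (‖dyadicAvg (-N) f x‖ₑ ^ p.toReal) ^ (1 / p.toReal) := by
          rw [← ENNReal.rpow_mul, mul_one_div_cancel hp0.ne', ENNReal.rpow_one]
      _ ≤ _ := ENNReal.rpow_le_rpow h2 (by positivity)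
  have hlim : Tendsto (fun N : ℕ => (ENNReal.ofReal (2⁻¹ ^ N) * A) ^ (1 / p.toReal)) atTop
      (𝓝 0) := by
    have h1 : Tendsto (fun N : ℕ => ENNReal.ofReal (2⁻¹ ^ N)) atTop (𝓝 0) := by
      have := ENNReal.tendsto_ofReal (tendsto_pow_atTop_nhds_zero_of_lt_one
        (by norm_num : (0 : ℝ) ≤ 2⁻¹) (by norm_num))
      simpa using this
    have h2 := ENNReal.Tendsto.mul_const h1 (Or.inr hAfin)
    have h3 := ((ENNReal.continuous_rpow_const (y := 1 / p.toReal)).tendsto _).comp h2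
    rw [zero_mul, ENNReal.zero_rpow_of_pos (by positivity)] at h3
    exact h3
  have h0 := tendsto_of_tendsto_of_tendsto_of_le_of_le tendsto_const_nhds hlim
    (fun _ => zero_le) hbound
  have h1 := (ENNReal.tendsto_toReal ENNReal.zero_ne_top).comp h0
  rw [tendsto_zero_iff_norm_tendsto_zero]
  simpa [Function.comp_def] using h1

/-- Lebesgue differentiation for dyadic averages. -/
theorem ae_tendsto_dyadicAvg {f : ℝ → ℝ} (hf : DyadicIntegrable f) :
    ∀ᵐ x ∂posVolume, Tendsto (fun N : ℕ => dyadicAvg N f x) atTop (𝓝 (f x)) := by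
  have hloc : LocallyIntegrable ((Ici 0).indicator f) volume := fun x => by
    obtain ⟨n, hn⟩ := pow_unbounded_of_one_lt x (one_lt_two (α := ℝ))
    refine ⟨Iio (2 ^ n), Iio_mem_nhds hn, ?_⟩
    rw [IntegrableOn, integrable_indicator_iff measurableSet_Ici, IntegrableOn,
      Measure.restrict_restrict measurableSet_Ici, Ici_inter_Iio]
    have h := hf (-n) 0
    rw [IntegrableOn, posVolume_restrict_dyadicInterval] at h
    simpa [dyadicInterval] using h
  -- This form of differentiation allows balls not centred at `x`: the ball about the midpoint of a
  -- dyadic interval is its closure, and the extra endpoint is null.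
  have hae := IsUnifLocDoublingMeasure.ae_tendsto_average.{_, _, 0} volume hloc 1
  filter_upwards [ae_restrict_of_ae hae, ae_posVolume_nonneg] with x hx hx0
  set w : ℕ → ℝ := fun N => ((dyadicIndex N x : ℝ) + 1 / 2) * 2 ^ (-(N : ℤ)) with hw
  set δ : ℕ → ℝ := fun N => 1 / 2 * 2 ^ (-(N : ℤ)) with hδ
  have hpos : ∀ N : ℕ, (0 : ℝ) < 2 ^ (-(N : ℤ)) := fun N => by positivity
  have hδlim : Tendsto δ atTop (𝓝[>] 0) := by
    refine tendsto_nhdsWithin_iff.2 ⟨?_, Eventually.of_forall fun N => by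
      exact mul_pos (by norm_num) (hpos N)⟩
    have h1 := (tendsto_pow_atTop_nhds_zero_of_lt_one
      (by norm_num : (0 : ℝ) ≤ 2⁻¹) (by norm_num)).const_mul (1 / 2)
    simpa [hδ] using h1
  have hball : ∀ N, Metric.closedBall (w N) (δ N) =
      Icc ((dyadicIndex N x : ℝ) * 2 ^ (-(N : ℤ)))
        (((dyadicIndex N x : ℝ) + 1) * 2 ^ (-(N : ℤ))) := fun N => by
    rw [Real.closedBall_eq_Icc]
    congr 1 <;> simp only [hw, hδ] <;> ring
  have hmem : ∀ N : ℕ, x ∈ dyadicInterval N (dyadicIndex N x) := fun N =>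
    mem_dyadicInterval_dyadicIndex N hx0
  have h := hx w δ hδlim (Eventually.of_forall fun N => by
    rw [one_mul, hball]
    exact Ico_subset_Icc_self (hmem N))
  rw [indicator_of_mem (mem_Ici.2 hx0)] at h
  refine h.congr fun N => ?_
  rw [hball, setAverage_eq, integral_Icc_eq_integral_Ico, Real.volume_real_Icc_of_le
    (mul_le_mul_of_nonneg_right (by linarith) (hpos N).le), dyadicAvg, smul_eq_mul]
  have e : ∫ y in dyadicInterval N (dyadicIndex N x), f y ∂posVolume =
      ∫ y in dyadicInterval N (dyadicIndex N x), (Ici 0).indicator f y := by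
    rw [posVolume_restrict_dyadicInterval]
    refine setIntegral_congr_fun (measurableSet_dyadicInterval _ _) fun y hy => ?_
    exact (indicator_of_mem (dyadicInterval_subset_Ici _ _ hy) f).symm
  rw [e, ← sub_mul, add_sub_cancel_left, one_mul, zpow_neg, inv_inv]
  simp only [dyadicInterval, zpow_neg]

/-! ### Converse estimate by duality. -/

theorem sum_dyadicDiff (f : ℝ → ℝ) (N : ℕ) (x : ℝ) :
    ∑ i ∈ Finset.range (2 * N), dyadicDiff (-N + i) f x =
      dyadicAvg N f x - dyadicAvg (-N) f x := by
  have h := Finset.sum_range_sub (fun i : ℕ => dyadicAvg (-N + i) f x) (2 * N)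
  have e : -(N : ℤ) + (2 * N : ℕ) = N := by push_cast; ring
  simp only [e, Nat.cast_zero, add_zero] at h
  rw [← h]
  refine Finset.sum_congr rfl fun i _ => ?_
  rw [dyadicDiff]; push_cast; rw [add_assoc]

/-- Write `g = (g - E_{n+1} g) + E_n g + D_n g`, with `E` the averages and `D` the differences. The
first term is orthogonal to level-`(n + 1)` functions such as `D_n f`; the second is of level `n`,
to which `D_n f` is orthogonal. -/
theorem integral_dyadicDiff_mul {p q : ℝ≥0∞} (hp₁ : 1 < p) (hp₂ : p < ∞) (hq₁ : 1 < q)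
    (hq₂ : q < ∞) [ENNReal.HolderTriple p q 1] {f g : ℝ → ℝ} (hf : MemLp f p posVolume)
    (hg : MemLp g q posVolume) (n : ℤ) :
    ∫ x, dyadicDiff n f x * g x ∂posVolume =
      ∫ x, dyadicDiff n f x * dyadicDiff n g x ∂posVolume := by
  have hd := memLp_dyadicDiff hp₁ hp₂ hf n
  have hg1 := memLp_dyadicAvg hq₁ hq₂ hg (n + 1)
  have hg0 := memLp_dyadicAvg hq₁ hq₂ hg n
  have hmeas : Measurable[MeasurableSpace.comap (dyadicIndex (n + 1)) ⊤] (dyadicDiff n f) :=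
    (measurable_dyadicAvg_comap (n + 1) f).sub
      ((measurable_dyadicAvg_comap n f).mono (comap_dyadicIndex_mono_succ n) le_rfl)
  have h1 := integral_mul_sub_dyadicAvg_eq_zero (hg.dyadicIntegrable hq₁.le) hmeas
    (hd.integrable_mul (hg.sub hg1))
  have h2 := integral_mul_dyadicDiff_eq_zero (hf.dyadicIntegrable hp₁.le)
    (measurable_dyadicAvg_comap n g)
    ((hd.integrable_mul hg0).congr (ae_of_all _ fun x => mul_comm _ _))
  have i1 : Integrable (fun x => dyadicDiff n f x * (g x - dyadicAvg (n + 1) g x)) posVolume :=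
    hd.integrable_mul (hg.sub hg1)
  have i2 : Integrable (fun x => dyadicAvg n g x * dyadicDiff n f x) posVolume :=
    (hd.integrable_mul hg0).congr (ae_of_all _ fun x => mul_comm _ _)
  have i3 : Integrable (fun x => dyadicDiff n f x * dyadicDiff n g x) posVolume :=
    hd.integrable_mul (memLp_dyadicDiff hq₁ hq₂ hg n)
  have e : ∀ x, dyadicDiff n f x * g x =
      (dyadicDiff n f x * (g x - dyadicAvg (n + 1) g x) + dyadicAvg n g x * dyadicDiff n f x) +
        dyadicDiff n f x * dyadicDiff n g x := fun x => by
    simp only [dyadicDiff]; ring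
  have i12 : Integrable (fun x => dyadicDiff n f x * (g x - dyadicAvg (n + 1) g x) +
    dyadicAvg n g x * dyadicDiff n f x) posVolume := i1.add i2
  simp only [e]
  rw [integral_add i12 i3, integral_add i1 i2, h1, h2, add_zero, zero_add]

theorem sum_enorm_dyadicDiff_mul_le (f g : ℝ → ℝ) (N : ℕ) (x : ℝ) :
    ‖∑ i ∈ Finset.range (2 * N), dyadicDiff (-N + i) f x * dyadicDiff (-N + i) g x‖ₑ ≤
      dyadicSquare f x * dyadicSquare g x := by
  have key : ∀ u : ℝ → ℝ, (∑ j ∈ Finset.Ico (-N : ℤ) N, ‖dyadicDiff j u x‖ₑ ^ (2 : ℝ)) ^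
      (1 / 2 : ℝ) ≤ dyadicSquare u x := fun u => by
    refine ENNReal.rpow_le_rpow ?_ (by norm_num)
    refine le_trans (le_of_eq (Finset.sum_congr rfl fun j _ => ?_)) (ENNReal.sum_le_tsum _)
    rw [← sq_abs, ENNReal.ofReal_pow (abs_nonneg _), Real.enorm_eq_ofReal_abs]
    norm_cast
  rw [sum_range_eq_sum_Ico_neg (fun j => dyadicDiff j f x * dyadicDiff j g x)]
  calc _ ≤ ∑ j ∈ Finset.Ico (-N : ℤ) N, ‖dyadicDiff j f x * dyadicDiff j g x‖ₑ := enorm_sum_le _ _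
    _ = ∑ j ∈ Finset.Ico (-N : ℤ) N, ‖dyadicDiff j f x‖ₑ * ‖dyadicDiff j g x‖ₑ := by
      simp only [enorm_mul]
    _ ≤ _ := ENNReal.inner_le_Lp_mul_Lq _ _ _ (Real.holderConjugate_iff.2 ⟨by norm_num, by norm_num⟩)
    _ ≤ _ := mul_le_mul' (key f) (key g)

/-- The pairing of a truncated Haar expansion with a function is controlled by the square
functions. -/
theorem enorm_integral_mul_le_dyadicSquare {p q : ℝ≥0∞} (hp₁ : 1 < p) (hp₂ : p < ∞) (hq₁ : 1 < q)
    (hq₂ : q < ∞) [hpq : ENNReal.HolderTriple p q 1] {f g : ℝ → ℝ} (hf : MemLp f p posVolume)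
    (hg : MemLp g q posVolume) (N : ℕ) :
    ‖∫ x, (dyadicAvg N f x - dyadicAvg (-N) f x) * g x ∂posVolume‖ₑ ≤
      eLpNorm (dyadicSquare f) p posVolume * eLpNorm (dyadicSquare g) q posVolume := by
  have hconj : p.toReal.HolderConjugate q.toReal :=
    ENNReal.HolderConjugate.toReal (one_lt_toReal hp₁ hp₂)
  have e1 : ∫ x, (dyadicAvg N f x - dyadicAvg (-N) f x) * g x ∂posVolume =
      ∫ x, ∑ i ∈ Finset.range (2 * N),
        dyadicDiff (-N + i) f x * dyadicDiff (-N + i) g x ∂posVolume := by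
    simp only [← sum_dyadicDiff, Finset.sum_mul]
    have i1 : ∀ n, Integrable (fun x => dyadicDiff n f x * g x) posVolume := fun n =>
      (memLp_dyadicDiff hp₁ hp₂ hf n).integrable_mul hg
    have i2 : ∀ n, Integrable (fun x => dyadicDiff n f x * dyadicDiff n g x) posVolume := fun n =>
      (memLp_dyadicDiff hp₁ hp₂ hf n).integrable_mul (memLp_dyadicDiff hq₁ hq₂ hg n)
    rw [integral_finsetSum _ fun i _ => i1 _, integral_finsetSum _ fun i _ => i2 _]
    exact Finset.sum_congr rfl fun i _ => integral_dyadicDiff_mul hp₁ hp₂ hq₁ hq₂ hf hg _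
  rw [e1, eLpNorm_dyadicSquare_eq hp₁ hp₂, eLpNorm_dyadicSquare_eq hq₁ hq₂]
  refine (enorm_integral_le_lintegral_enorm _).trans
    ((lintegral_mono fun x => sum_enorm_dyadicDiff_mul_le f g N x).trans ?_)
  exact ENNReal.lintegral_mul_le_Lp_mul_Lq posVolume hconj
    (measurable_dyadicSquare f).aemeasurable (measurable_dyadicSquare g).aemeasurable

/-- Test against the extremal function `g |g|^{p-2}`. That `g` is already in `L^p` makes the common
factor finite, so it can be cancelled. -/
theorem eLpNorm_le_of_enorm_integral_mul_le {p q : ℝ≥0∞} (hp₁ : 1 < p) (hp₂ : p < ∞)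
    (hq₁ : 1 < q) (hq₂ : q < ∞) [ENNReal.HolderTriple p q 1] {g : ℝ → ℝ} {B : ℝ≥0∞}
    (hg : MemLp g p posVolume) (h : ∀ φ : ℝ → ℝ, MemLp φ q posVolume →
      ‖∫ x, g x * φ x ∂posVolume‖ₑ ≤ B * eLpNorm φ q posVolume) :
    eLpNorm g p posVolume ≤ B := by
  have hP := one_lt_toReal hp₁ hp₂
  have hp0 : p ≠ 0 := (zero_lt_one.trans hp₁).ne'
  have hq0 : q ≠ 0 := (zero_lt_one.trans hq₁).ne'
  have hconj : p.toReal.HolderConjugate q.toReal := ENNReal.HolderConjugate.toReal hP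
  set P := p.toReal
  set Q := q.toReal
  have hPQ : (P - 1) * Q = P := by
    have := hconj.sub_one_mul_conj
    linarith
  set A := ∫⁻ y, ‖g y‖ₑ ^ P ∂posVolume with hA
  have hAfin : A ≠ ∞ := (lintegral_rpow_enorm_lt_top_of_eLpNorm_lt_top hp0 hp₂.ne hg.2).ne
  set φ : ℝ → ℝ := fun x => g x * |g x| ^ (P - 2) with hφ
  have habs : ∀ x, |φ x| = |g x| ^ (P - 1) := fun x => by
    rw [hφ, abs_mul, abs_of_nonneg (Real.rpow_nonneg (abs_nonneg _) _), show P - 1 = 1 + (P - 2) by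
      ring, Real.rpow_one_add' (abs_nonneg _) (by linarith)]
  have hmul : ∀ x, g x * φ x = |g x| ^ P := fun x => by
    have h1 : g x * φ x = |g x| * |φ x| := by
      rw [← abs_mul, abs_of_nonneg]
      have : g x * φ x = (g x * g x) * |g x| ^ (P - 2) := by rw [hφ]; ring
      rw [this]
      exact mul_nonneg (mul_self_nonneg _) (Real.rpow_nonneg (abs_nonneg _) _)
    rw [h1, habs]
    conv_rhs => rw [show P = 1 + (P - 1) by ring,
      Real.rpow_one_add' (abs_nonneg _) (by linarith)]
  have henorm : ∀ x, ‖φ x‖ₑ ^ Q = ‖g x‖ₑ ^ P := fun x => by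
    rw [Real.enorm_eq_ofReal_abs, habs, ← ENNReal.ofReal_rpow_of_nonneg (abs_nonneg _)
      (by linarith), ← ENNReal.rpow_mul, hPQ, Real.enorm_eq_ofReal_abs]
  have hφm : AEStronglyMeasurable φ posVolume := by
    have : AEMeasurable g posVolume := hg.1.aemeasurable
    exact (this.mul ((continuous_abs.measurable.comp_aemeasurable this).pow_const
      (P - 2))).aestronglyMeasurable
  have hφnorm : eLpNorm φ q posVolume = A ^ (1 / Q) := by
    rw [eLpNorm_eq_lintegral_rpow_enorm_toReal hq0 hq₂.ne]
    simp only [Q, P] at henorm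
    simp only [henorm, hA, P, Q]
  have hφL : MemLp φ q posVolume := ⟨hφm, by
    rw [hφnorm]
    exact ENNReal.rpow_lt_top_of_nonneg (by positivity) hAfin⟩
  have hgi : Integrable (fun x => |g x| ^ P) posVolume := hg.integrable_norm_rpow hp0 hp₂.ne
  have hpair : ‖∫ x, g x * φ x ∂posVolume‖ₑ = A := by
    simp only [hmul]
    rw [Real.enorm_of_nonneg (integral_nonneg fun x => Real.rpow_nonneg (abs_nonneg _) _),
      ofReal_integral_eq_lintegral_ofReal hgi
        (ae_of_all _ fun x => Real.rpow_nonneg (abs_nonneg _) _)]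
    refine lintegral_congr fun x => ?_
    rw [← ENNReal.ofReal_rpow_of_nonneg (abs_nonneg _) (by linarith), Real.enorm_eq_ofReal_abs]
  have hfin := h φ hφL
  rw [hpair, hφnorm] at hfin
  rw [eLpNorm_eq_lintegral_rpow_enorm_toReal hp0 hp₂.ne]
  change A ^ (1 / P) ≤ B
  rcases eq_or_ne A 0 with h0 | h0
  · rw [h0, ENNReal.zero_rpow_of_pos (by positivity)]
    exact zero_le
  · have hAQ0 : A ^ (1 / Q) ≠ 0 := by
      simp [ENNReal.rpow_eq_zero_iff, h0, hAfin]
    have hAQ : A ^ (1 / Q) ≠ ∞ := ENNReal.rpow_ne_top_of_nonneg (by positivity) hAfin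
    have hsplit : A = A ^ (1 / P) * A ^ (1 / Q) := by
      rw [← ENNReal.rpow_add _ _ h0 hAfin, one_div, one_div, hconj.inv_add_inv_eq_one,
        ENNReal.rpow_one]
    exact (ENNReal.mul_le_mul_iff_left hAQ0 hAQ).1 (hsplit.ge.trans hfin)

/-- The dyadic square function controls the `L^p` norm. -/
theorem exists_eLpNorm_le_dyadicSquare {p : ℝ≥0∞} (hp₁ : 1 < p) (hp₂ : p < ∞) :
    ∃ C : ℝ≥0, ∀ f : ℝ → ℝ, MemLp f p posVolume →
      eLpNorm f p posVolume ≤ C * eLpNorm (dyadicSquare f) p posVolume := by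
  have hP := one_lt_toReal hp₁ hp₂
  have hconj := Real.HolderConjugate.conjExponent hP
  set q : ℝ≥0∞ := ENNReal.ofReal (Real.conjExponent p.toReal) with hq
  have hq₁ : 1 < q := by
    rw [hq, ← ENNReal.ofReal_one]
    exact (ENNReal.ofReal_lt_ofReal_iff hconj.symm.pos).2 hconj.symm.lt
  have hq₂ : q < ∞ := ENNReal.ofReal_lt_top
  have hpq : ENNReal.HolderTriple p q 1 := ENNReal.HolderConjugate.of_toReal (by
    rw [hq, ENNReal.toReal_ofReal hconj.symm.nonneg]; exact hconj)
  -- The constant is that of the direct estimate at the conjugate exponent.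
  obtain ⟨C, hC⟩ := exists_eLpNorm_dyadicSquare_le hq₁ hq₂
  refine ⟨C, fun f hf => ?_⟩
  have hmem : ∀ N : ℕ, MemLp (fun x => dyadicAvg N f x - dyadicAvg (-N) f x) p posVolume :=
    fun N => (memLp_dyadicAvg hp₁ hp₂ hf _).sub (memLp_dyadicAvg hp₁ hp₂ hf _)
  have hN : ∀ N : ℕ, eLpNorm (fun x => dyadicAvg N f x - dyadicAvg (-N) f x) p posVolume ≤
      C * eLpNorm (dyadicSquare f) p posVolume := fun N => by
    refine eLpNorm_le_of_enorm_integral_mul_le hp₁ hp₂ hq₁ hq₂ (hmem N) fun φ hφ => ?_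
    refine (enorm_integral_mul_le_dyadicSquare hp₁ hp₂ hq₁ hq₂ hf hφ N).trans ?_
    rw [mul_comm (C : ℝ≥0∞), mul_assoc]
    gcongr
    exact hC φ hφ
  have hlim : ∀ᵐ x ∂posVolume, Tendsto (fun N : ℕ => dyadicAvg N f x - dyadicAvg (-N) f x) atTop
      (𝓝 (f x)) := by
    filter_upwards [ae_tendsto_dyadicAvg (hf.dyadicIntegrable hp₁.le)] with x hx
    simpa using hx.sub (tendsto_dyadicAvg_neg hp₁ hp₂ hf x)
  refine (Lp.eLpNorm_lim_le_liminf_eLpNorm (fun N => (hmem N).1) f hlim).trans ?_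
  exact liminf_le_of_le (by isBoundedDefault) fun b hb => by
    obtain ⟨N, hN'⟩ := hb.exists
    exact hN'.trans (hN N)

end SquareFunction

/-! ### Level sets of the dyadic distance, kernel masses, and eigenvalues. -/

section KernelStructure

theorem dyadicIndex_eq_of_le {i j : ℤ} (hij : i ≤ j) {x y : ℝ}
    (h : dyadicIndex j x = dyadicIndex j y) : dyadicIndex i x = dyadicIndex i y := by
  obtain ⟨n, rfl⟩ := Int.le.dest hij
  induction n with
  | zero => simpa using h
  | succ n ih =>
    refine ih (by omega) ?_
    rw [dyadicIndex_eq_div (i + n) x, dyadicIndex_eq_div (i + n) y]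
    have : i + (n : ℤ) + 1 = i + ((n + 1 : ℕ) : ℤ) := by push_cast; ring
    rw [this, h]

/-- The pairs whose smallest common dyadic interval has level `n`. -/
def levelSet (n : ℤ) : Set (ℝ × ℝ) :=
  {z | dyadicIndex n z.1 = dyadicIndex n z.2 ∧ dyadicIndex (n + 1) z.1 ≠ dyadicIndex (n + 1) z.2}

theorem mem_levelSet {n : ℤ} {x y : ℝ} : (x, y) ∈ levelSet n ↔
    dyadicIndex n x = dyadicIndex n y ∧ dyadicIndex (n + 1) x ≠ dyadicIndex (n + 1) y := Iff.rfl

theorem mem_levelSet_comm {n : ℤ} {x y : ℝ} : (x, y) ∈ levelSet n ↔ (y, x) ∈ levelSet n := by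
  rw [mem_levelSet, mem_levelSet, eq_comm, ne_comm]

theorem measurableSet_levelSet (n : ℤ) : MeasurableSet (levelSet n) :=
  (measurableSet_eq_fun ((measurable_dyadicIndex n).comp measurable_fst)
    ((measurable_dyadicIndex n).comp measurable_snd)).inter
  (measurableSet_eq_fun ((measurable_dyadicIndex (n + 1)).comp measurable_fst)
    ((measurable_dyadicIndex (n + 1)).comp measurable_snd)).compl

theorem levelSet_unique {m n : ℤ} {x y : ℝ} (hm : (x, y) ∈ levelSet m)
    (hn : (x, y) ∈ levelSet n) : m = n := by
  rcases lt_trichotomy m n with h | h | h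
  · exact absurd (dyadicIndex_eq_of_le (by omega) hn.1) hm.2
  · exact h
  · exact absurd (dyadicIndex_eq_of_le (by omega) hm.1) hn.2

theorem dyadicDist_of_mem_levelSet {n : ℤ} {x y : ℝ} (hx : 0 ≤ x) (hy : 0 ≤ y)
    (h : (x, y) ∈ levelSet n) : dyadicDist x y = 2 ^ (-n) := by
  apply IsLeast.csInf_eq
  constructor
  · exact ⟨n, dyadicIndex n x, mem_dyadicInterval_iff.2 ⟨hx, rfl⟩,
      mem_dyadicInterval_iff.2 ⟨hy, h.1.symm⟩, (volume_real_dyadicInterval _ _).symm⟩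
  · rintro r ⟨j, k, hjx, hjy, rfl⟩
    rw [volume_real_dyadicInterval]
    have hj : dyadicIndex j x = dyadicIndex j y := by
      rw [(mem_dyadicInterval_iff.1 hjx).2, (mem_dyadicInterval_iff.1 hjy).2]
    have hjn : j ≤ n := by
      by_contra hlt
      exact h.2 (dyadicIndex_eq_of_le (by omega) hj)
    exact zpow_le_zpow_right₀ (by norm_num) (by omega)

/-- The levels at which the two indices agree are bounded above because the points are distinct, and
they exist because a large interval at the origin contains both; take the greatest. -/
theorem exists_mem_levelSet {x y : ℝ} (hx : 0 ≤ x) (hy : 0 ≤ y) (hxy : x ≠ y) :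
    ∃ n, (x, y) ∈ levelSet n := by
  have hbdd : ∃ b : ℤ, ∀ n : ℤ, dyadicIndex n x = dyadicIndex n y → n ≤ b := by
    have habs : 0 < |x - y| := abs_pos.2 (sub_ne_zero.2 hxy)
    obtain ⟨b, hb⟩ := pow_unbounded_of_one_lt |x - y|⁻¹ (one_lt_two (α := ℝ))
    refine ⟨b, fun n hn => ?_⟩
    by_contra hlt
    have hn' := dyadicIndex_eq_of_le (not_le.1 hlt).le hn
    have h2 : (0 : ℝ) < 2 ^ (b : ℤ) := by positivity
    have h3 := (Nat.floor_eq_iff (by positivity : (0 : ℝ) ≤ 2 ^ (b : ℤ) * x)).1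
      (rfl : _ = dyadicIndex b x)
    have h4 := (Nat.floor_eq_iff (by positivity : (0 : ℝ) ≤ 2 ^ (b : ℤ) * y)).1
      (rfl : _ = dyadicIndex b y)
    rw [← hn'] at h4
    have h5 : |2 ^ (b : ℤ) * x - 2 ^ (b : ℤ) * y| < 1 := by
      rw [abs_lt]; constructor <;> linarith
    rw [← mul_sub, abs_mul, abs_of_pos h2, zpow_natCast] at h5
    rw [inv_lt_iff_one_lt_mul₀ habs] at hb
    linarith
  have hex : ∃ n : ℤ, dyadicIndex n x = dyadicIndex n y := by
    obtain ⟨b, hb⟩ := pow_unbounded_of_one_lt (max x y) (one_lt_two (α := ℝ))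
    have key : ∀ z : ℝ, z < 2 ^ b → dyadicIndex (-b) z = 0 := fun z hz => by
      rw [dyadicIndex, Nat.floor_eq_zero, zpow_neg, zpow_natCast,
        inv_mul_lt_iff₀ (by positivity), mul_one]
      exact hz
    exact ⟨-b, by rw [key x ((le_max_left _ _).trans_lt hb),
      key y ((le_max_right _ _).trans_lt hb)]⟩
  obtain ⟨n, hn, hmax⟩ := Int.exists_greatest_of_bdd hbdd hex
  exact ⟨n, hn, fun h => by have := hmax _ h; omega⟩

variable {K : ℝ → ℝ → ℝ}

/-- The mass `k_{-n} 2^{-n-1}` of the kernel on the pairs of level `n`. -/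
def levelMass (K : ℝ → ℝ → ℝ) (n : ℤ) : ℝ := levelCoeff K (-n) * 2 ^ (-(n + 1))

/-- A measurable, symmetric version of the kernel, with values in `[0, ∞]`. -/
def kernelENN (K : ℝ → ℝ → ℝ) (x y : ℝ) : ℝ≥0∞ :=
  ∑' n : ℤ, (levelSet n).indicator (fun _ => ENNReal.ofReal (levelCoeff K (-n))) (x, y)

theorem measurable_kernelENN (K : ℝ → ℝ → ℝ) : Measurable (Function.uncurry (kernelENN K)) :=
  Measurable.tsum fun n => measurable_const.indicator (measurableSet_levelSet n)

theorem kernelENN_comm (K : ℝ → ℝ → ℝ) (x y : ℝ) : kernelENN K x y = kernelENN K y x := by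
  refine tsum_congr fun n => ?_
  by_cases h : (x, y) ∈ levelSet n
  · rw [indicator_of_mem h, indicator_of_mem (mem_levelSet_comm.1 h)]
  · rw [indicator_of_notMem h, indicator_of_notMem (mt mem_levelSet_comm.1 h)]

theorem kernelENN_of_mem {n : ℤ} {x y : ℝ} (h : (x, y) ∈ levelSet n) :
    kernelENN K x y = ENNReal.ofReal (levelCoeff K (-n)) := by
  rw [kernelENN, tsum_eq_single n, indicator_of_mem h]
  intro m hm
  exact indicator_of_notMem (fun h' => hm (levelSet_unique h' h)) _

theorem IsDyadicMarkovKernel.levelCoeff_nonneg (hK : IsDyadicMarkovKernel K) (n : ℤ) :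
    0 ≤ levelCoeff K n := hK.nonneg _ _ le_rfl (by positivity)

theorem IsDyadicMarkovKernel.levelMass_nonneg (hK : IsDyadicMarkovKernel K) (n : ℤ) :
    0 ≤ levelMass K n := mul_nonneg (hK.levelCoeff_nonneg _) (by positivity)

/-- Only the diagonal escapes the level sets, and its sections are null. This replaces `K`,
arbitrary outside `ℝ⁺ × ℝ⁺`, by a jointly measurable kernel. -/
theorem IsDyadicMarkovKernel.ae_kernelENN (hK : IsDyadicMarkovKernel K) {x : ℝ} (hx : 0 ≤ x) :
    ∀ᵐ y ∂posVolume, kernelENN K x y = ENNReal.ofReal (K x y) ∧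
      K x y = (kernelENN K x y).toReal := by
  have hne : ∀ᵐ y ∂posVolume, y ≠ x := ae_restrict_of_ae (Measure.ae_ne volume x)
  filter_upwards [ae_posVolume_nonneg, hne] with y hy hyx
  obtain ⟨n, hn⟩ := exists_mem_levelSet hx hy hyx.symm
  have h := hK.eq_levelCoeff hx hy (dyadicDist_of_mem_levelSet hx hy hn)
  rw [kernelENN_of_mem hn, h, ENNReal.toReal_ofReal (hK.levelCoeff_nonneg _)]
  exact ⟨rfl, rfl⟩

/-- Up to a null set, the section is the level-`n` interval of `y` without the half containing `y`.
-/
theorem posVolume_levelSet_section (y : ℝ) (n : ℤ) :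
    posVolume {x | (x, y) ∈ levelSet n} = ENNReal.ofReal (2 ^ (-(n + 1))) := by
  have h1 : ({x | (x, y) ∈ levelSet n} : Set ℝ) =ᵐ[posVolume]
      (dyadicInterval n (dyadicIndex n y) \ dyadicInterval (n + 1) (dyadicIndex (n + 1) y) :
        Set ℝ) := by
    filter_upwards [ae_posVolume_nonneg] with x hx
    refine propext ?_
    change (x, y) ∈ levelSet n ↔ x ∈ dyadicInterval n (dyadicIndex n y) \
      dyadicInterval (n + 1) (dyadicIndex (n + 1) y)
    simp [mem_levelSet, mem_dyadicInterval_iff, hx]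
  have hsub : dyadicInterval (n + 1) (dyadicIndex (n + 1) y) ⊆
      dyadicInterval n (dyadicIndex n y) := fun x hx => by
    rw [mem_dyadicInterval_iff] at hx ⊢
    exact ⟨hx.1, dyadicIndex_eq_of_le (by omega) hx.2⟩
  rw [measure_congr h1, measure_sdiff hsub (measurableSet_dyadicInterval _ _).nullMeasurableSet
    (by rw [posVolume_dyadicInterval]; exact ENNReal.ofReal_ne_top), posVolume_dyadicInterval,
    posVolume_dyadicInterval, ← ENNReal.ofReal_sub _ (by positivity)]
  congr 1
  rw [show -n = -(n + 1) + 1 by ring, zpow_add_one₀ (by norm_num)]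
  ring

theorem setLIntegral_kernelENN {y : ℝ} {s : Set ℝ} :
    ∫⁻ x in s, kernelENN K x y ∂posVolume = ∑' n : ℤ,
      ENNReal.ofReal (levelCoeff K (-n)) * posVolume ({x | (x, y) ∈ levelSet n} ∩ s) := by
  have hm : ∀ n : ℤ, MeasurableSet {x | (x, y) ∈ levelSet n} := fun n =>
    measurable_prodMk_right (measurableSet_levelSet n)
  have h : ∀ x, kernelENN K x y = ∑' n : ℤ, {x | (x, y) ∈ levelSet n}.indicator
      (fun _ => ENNReal.ofReal (levelCoeff K (-n))) x := fun x => rfl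
  simp only [h]
  rw [lintegral_tsum fun n => (measurable_const.indicator (hm n)).aemeasurable]
  refine tsum_congr fun n => ?_
  rw [lintegral_indicator (hm n), setLIntegral_const, Measure.restrict_apply (hm n)]

theorem ofReal_levelMass (hK : IsDyadicMarkovKernel K) (n : ℤ) :
    ENNReal.ofReal (levelMass K n) =
      ENNReal.ofReal (levelCoeff K (-n)) * ENNReal.ofReal (2 ^ (-(n + 1))) :=
  ENNReal.ofReal_mul (hK.levelCoeff_nonneg _)

theorem lintegral_kernelENN (hK : IsDyadicMarkovKernel K) (y : ℝ) :
    ∫⁻ x, kernelENN K x y ∂posVolume = ∑' n : ℤ, ENNReal.ofReal (levelMass K n) := by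
  rw [← setLIntegral_univ, setLIntegral_kernelENN]
  simp only [inter_univ, posVolume_levelSet_section y, ofReal_levelMass hK]

/-- The kernel is stochastic at every point. -/
theorem tsum_levelMass (hK : IsDyadicMarkovKernel K) :
    ∑' n : ℤ, ENNReal.ofReal (levelMass K n) = 1 := by
  obtain ⟨x₀, hx₀, h⟩ := hK.exists_integral_eq_one
  -- Integrability is forced, since the integral of a non-integrable function is `0` by convention.
  have hi : Integrable (K x₀) posVolume := by
    by_contra hn
    rw [integral_undef hn] at h
    exact zero_ne_one h
  have hnn : 0 ≤ᵐ[posVolume] K x₀ := by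
    filter_upwards [ae_posVolume_nonneg] with y hy using hK.nonneg _ _ hx₀ hy
  have h2 := ofReal_integral_eq_lintegral_ofReal hi hnn
  rw [h, ENNReal.ofReal_one] at h2
  rw [h2, ← lintegral_kernelENN hK x₀]
  refine lintegral_congr_ae ?_
  filter_upwards [hK.ae_kernelENN hx₀] with y hy
  rw [← hy.1, kernelENN_comm]

theorem lintegral_kernelENN_eq_one (hK : IsDyadicMarkovKernel K) (y : ℝ) :
    ∫⁻ x, kernelENN K x y ∂posVolume = 1 := by
  rw [lintegral_kernelENN hK y, tsum_levelMass hK]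

theorem summable_levelMass (hK : IsDyadicMarkovKernel K) : Summable (levelMass K) := by
  have h : ∑' n : ℤ, ENNReal.ofReal (levelMass K n) ≠ ∞ := by simp [tsum_levelMass hK]
  have := ENNReal.summable_toReal h
  simpa only [ENNReal.toReal_ofReal (hK.levelMass_nonneg _)] using this

theorem alphaCoeff_eq (K : ℝ → ℝ → ℝ) (l : ℤ) :
    alphaCoeff K l = 2 * levelMass K l - levelMass K (l - 1) := by
  have e1 : (2 : ℝ) ^ (-l) = 2 ^ (-(l + 1)) * 2 := by
    rw [← zpow_add_one₀ (by norm_num)]; congr 1; ring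
  have e2 : -(l - 1 + 1) = -l := by ring
  have e3 : -(l - 1) = -l + 1 := by ring
  rw [alphaCoeff, levelMass, levelMass, e2, e3, mul_sub]
  nth_rewrite 1 [e1]
  ring

theorem tsum_Ioi_shift {a : ℤ → ℝ} (ha : Summable a) (j : ℤ) :
    ∑' l : Ioi j, a (l - 1) = a j + ∑' l : Ioi j, a l := by
  have e3 : ∑' l : ℤ, ({j} : Set ℤ).indicator a l = a j := by
    rw [tsum_eq_single j]
    · simp
    · intro l hl
      simp [hl]
  rw [tsum_subtype (Ioi j) fun l => a (l - 1), tsum_subtype (Ioi j) a, ← e3,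
    ← Summable.tsum_add (ha.indicator _) (ha.indicator _), ← (Equiv.addRight (1 : ℤ)).tsum_eq]
  refine tsum_congr fun l => ?_
  simp only [Equiv.coe_addRight, indicator, mem_Ioi, mem_singleton_iff, add_sub_cancel_right]
  rcases lt_trichotomy l j with h | h | h
  · simp [show ¬ j < l + 1 by omega, show ¬ l = j by omega, show ¬ j < l by omega]
  · simp [h]
  · simp [show j < l + 1 by omega, show ¬ l = j by omega, h]

/-- Summing `2 m_l - m_{l-1}` over `l > j` gives `2 A - (m_j + A)` with `A = ∑_{l>j} m_l`. All
series converge because the masses are summable. -/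
theorem eigenvalue_eq (hK : IsDyadicMarkovKernel K) (j : ℤ) :
    eigenvalue K j = ∑' l : Ioi j, levelMass K l - levelMass K j := by
  have hs := summable_levelMass hK
  have h1 : eigenvalue K j = ∑' l : Ioi j, alphaCoeff K l := rfl
  have h2 : Summable fun l : Ioi j => levelMass K l := hs.comp_injective Subtype.val_injective
  have h3 : Summable fun l : Ioi j => levelMass K ((l : ℤ) - 1) :=
    hs.comp_injective (sub_left_injective.comp Subtype.val_injective)
  have h4 := tsum_Ioi_shift hs j
  simp only [h1, alphaCoeff_eq]
  rw [(h2.mul_left 2).tsum_sub h3, tsum_mul_left, h4]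
  generalize ∑' l : Ioi j, levelMass K l = A
  generalize levelMass K j = B
  ring

/-- The mass of the kernel on the dyadic interval of level `j + 1` around a point. -/
theorem setLIntegral_kernelENN_self (hK : IsDyadicMarkovKernel K) (y : ℝ) (j : ℤ) :
    ∫⁻ x in dyadicInterval (j + 1) (dyadicIndex (j + 1) y), kernelENN K x y ∂posVolume =
      ∑' l : Ioi j, ENNReal.ofReal (levelMass K l) := by
  have e := tsum_subtype (Ioi j) fun l => ENNReal.ofReal (levelMass K l)
  refine Eq.trans ?_ e.symm
  rw [setLIntegral_kernelENN]
  refine tsum_congr fun n => ?_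
  by_cases hn : j < n
  · rw [indicator_of_mem (mem_Ioi.2 hn), ofReal_levelMass hK, ← posVolume_levelSet_section y n]
    congr 1
    refine measure_congr ?_
    filter_upwards [ae_posVolume_nonneg] with x hx
    refine propext ⟨fun h => h.1, fun h => ⟨h, ?_⟩⟩
    exact mem_dyadicInterval_iff.2 ⟨hx, dyadicIndex_eq_of_le (by omega) h.1⟩
  · rw [indicator_of_notMem (fun h => hn (mem_Ioi.1 h))]
    have : {x | (x, y) ∈ levelSet n} ∩ dyadicInterval (j + 1) (dyadicIndex (j + 1) y) = ∅ := by
      refine eq_empty_iff_forall_notMem.2 fun x hx => hx.1.2 ?_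
      exact dyadicIndex_eq_of_le (by omega) (mem_dyadicInterval_iff.1 hx.2).2
    rw [this, measure_empty, mul_zero]

theorem setLIntegral_kernelENN_of_forall {s : Set ℝ} (hs : MeasurableSet s) {y : ℝ} {c : ℝ≥0∞}
    (h : ∀ x ∈ s, kernelENN K x y = c) :
    ∫⁻ x in s, kernelENN K x y ∂posVolume = c * posVolume s := by
  rw [setLIntegral_congr_fun hs h, setLIntegral_const]

/-- The mass of the kernel on the sibling of the dyadic interval of level `j + 1` around a point. -/
theorem setLIntegral_kernelENN_sibling (hK : IsDyadicMarkovKernel K) {y : ℝ} {j : ℤ} {k : ℕ}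
    (hk : k / 2 = dyadicIndex j y) (hk' : k ≠ dyadicIndex (j + 1) y) :
    ∫⁻ x in dyadicInterval (j + 1) k, kernelENN K x y ∂posVolume =
      ENNReal.ofReal (levelMass K j) := by
  rw [setLIntegral_kernelENN_of_forall (measurableSet_dyadicInterval _ _) fun x hx =>
    kernelENN_of_mem (n := j) ?_, posVolume_dyadicInterval, ofReal_levelMass hK]
  have := (mem_dyadicInterval_iff.1 hx).2
  exact ⟨by rw [dyadicIndex_eq_div j x, this, hk], by rw [this]; exact hk'⟩

/-- All points of a dyadic interval not containing `y` have the same smallest common interval with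
`y`. -/
theorem kernelENN_congr_left {j : ℤ} {x x' y : ℝ} (h : dyadicIndex j x = dyadicIndex j x')
    (hy : dyadicIndex j x ≠ dyadicIndex j y) : kernelENN K x y = kernelENN K x' y := by
  refine tsum_congr fun n => ?_
  have key : (x, y) ∈ levelSet n ↔ (x', y) ∈ levelSet n := by
    rw [mem_levelSet, mem_levelSet]
    rcases le_or_gt j n with hn | hn
    · refine iff_of_false (fun h' => hy (dyadicIndex_eq_of_le hn h'.1)) fun h' => hy ?_
      rw [h, dyadicIndex_eq_of_le hn h'.1]
    · rw [dyadicIndex_eq_of_le hn.le h, dyadicIndex_eq_of_le (i := n + 1) (by omega) h]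
  by_cases hm : (x, y) ∈ levelSet n
  · rw [indicator_of_mem hm, indicator_of_mem (key.1 hm)]
  · rw [indicator_of_notMem hm, indicator_of_notMem (mt key.2 hm)]

/-- The kernel maps the Haar function of a dyadic interval to its multiple by the eigenvalue. -/
theorem setLIntegral_kernelENN_sub (hK : IsDyadicMarkovKernel K) {y : ℝ} (hy : 0 ≤ y) (j : ℤ)
    (k : ℕ) :
    (∫⁻ x in dyadicInterval (j + 1) (2 * k), kernelENN K x y ∂posVolume).toReal -
      (∫⁻ x in dyadicInterval (j + 1) (2 * k + 1), kernelENN K x y ∂posVolume).toReal =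
    eigenvalue K j * ((dyadicInterval (j + 1) (2 * k)).indicator 1 y -
      (dyadicInterval (j + 1) (2 * k + 1)).indicator 1 y) := by
  have hdiv := dyadicIndex_eq_div j y
  have hself : (∑' l : Ioi j, ENNReal.ofReal (levelMass K l)).toReal =
      ∑' l : Ioi j, levelMass K l := by
    rw [ENNReal.tsum_toReal_eq fun _ => ENNReal.ofReal_ne_top]
    exact tsum_congr fun l => ENNReal.toReal_ofReal (hK.levelMass_nonneg _)
  have hsib := ENNReal.toReal_ofReal (hK.levelMass_nonneg j)
  -- Left half: own mass minus sibling mass. The right half reverses the sign; outside the parent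
  -- the kernel is constant on it and the halves cancel.
  by_cases h0 : dyadicIndex (j + 1) y = 2 * k
  · have hm : y ∈ dyadicInterval (j + 1) (2 * k) := mem_dyadicInterval_iff.2 ⟨hy, h0⟩
    have hm' : y ∉ dyadicInterval (j + 1) (2 * k + 1) := fun h => by
      have := (mem_dyadicInterval_iff.1 h).2; omega
    rw [indicator_of_mem hm, indicator_of_notMem hm',
      setLIntegral_kernelENN_sibling hK (k := 2 * k + 1) (y := y) (by omega) (by omega), ← h0,
      setLIntegral_kernelENN_self hK y, hself, hsib, eigenvalue_eq hK]
    simp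
  by_cases h1 : dyadicIndex (j + 1) y = 2 * k + 1
  · have hm : y ∈ dyadicInterval (j + 1) (2 * k + 1) := mem_dyadicInterval_iff.2 ⟨hy, h1⟩
    have hm' : y ∉ dyadicInterval (j + 1) (2 * k) := fun h => by
      have := (mem_dyadicInterval_iff.1 h).2; omega
    rw [indicator_of_mem hm, indicator_of_notMem hm',
      setLIntegral_kernelENN_sibling hK (k := 2 * k) (y := y) (by omega) (by omega), ← h1,
      setLIntegral_kernelENN_self hK y, hself, hsib, eigenvalue_eq hK]
    simp
  · have hm : y ∉ dyadicInterval (j + 1) (2 * k + 1) := fun h => h1 (mem_dyadicInterval_iff.1 h).2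
    have hm' : y ∉ dyadicInterval (j + 1) (2 * k) := fun h => h0 (mem_dyadicInterval_iff.1 h).2
    have hky : k ≠ dyadicIndex j y := by omega
    obtain ⟨x₀, hx₀⟩ : ∃ x₀ : ℝ, dyadicIndex j x₀ = k := by
      refine ⟨k * 2 ^ (-j), ?_⟩
      rw [dyadicIndex, mul_left_comm, ← zpow_add₀ (by norm_num)]
      simp
    have key : ∀ i, i / 2 = k → ∫⁻ x in dyadicInterval (j + 1) i, kernelENN K x y ∂posVolume =
        kernelENN K x₀ y * ENNReal.ofReal (2 ^ (-(j + 1))) := fun i hi => by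
      rw [← posVolume_dyadicInterval (j + 1) i]
      refine setLIntegral_kernelENN_of_forall (measurableSet_dyadicInterval _ _) fun x hx => ?_
      have hxk : dyadicIndex j x = k := by
        rw [dyadicIndex_eq_div, (mem_dyadicInterval_iff.1 hx).2, hi]
      exact kernelENN_congr_left (j := j) (by rw [hxk, hx₀]) (by rw [hxk]; exact hky)
    rw [indicator_of_notMem hm, indicator_of_notMem hm', key _ (by omega), key _ (by omega)]
    simp

end KernelStructure

/-! ### Boundedness of `T` and its action on Haar coefficients. -/

section KernelOperator

variable {K : ℝ → ℝ → ℝ} {p : ℝ≥0∞} {f : ℝ → ℝ}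

theorem lintegral_kernelENN_mul_rpow_le (hK : IsDyadicMarkovKernel K) (hp₁ : 1 < p) (hp₂ : p < ∞)
    (hf : AEStronglyMeasurable f posVolume) :
    ∫⁻ x, (∫⁻ y, kernelENN K x y * ‖f y‖ₑ ∂posVolume) ^ p.toReal ∂posVolume ≤
      ∫⁻ y, ‖f y‖ₑ ^ p.toReal ∂posVolume := by
  have h2 : ∀ y, ∫⁻ x, kernelENN K x y ∂posVolume ≤ 1 := fun y =>
    (lintegral_kernelENN_eq_one hK y).le
  have h1 : ∀ x, ∫⁻ y, kernelENN K x y ∂posVolume ≤ 1 := fun x => by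
    simp only [kernelENN_comm K x]
    exact h2 x
  exact lintegral_rpow_lintegral_kernel_le (one_lt_toReal hp₁ hp₂) (measurable_kernelENN K)
    (ae_of_all _ h1) (ae_of_all _ h2) hf.enorm

theorem aemeasurable_kernelENN_mul (hf : AEStronglyMeasurable f posVolume) (μ : Measure ℝ)
    [SFinite μ] :
    AEMeasurable (fun z : ℝ × ℝ => kernelENN K z.1 z.2 * ‖f z.2‖ₑ) (μ.prod posVolume) :=
  (measurable_kernelENN K).aemeasurable.mul hf.comp_snd.enorm

theorem aestronglyMeasurable_kernelENN_toReal_mul (hf : AEStronglyMeasurable f posVolume)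
    (μ : Measure ℝ) [SFinite μ] :
    AEStronglyMeasurable (fun z : ℝ × ℝ => (kernelENN K z.1 z.2).toReal * f z.2)
      (μ.prod posVolume) :=
  (measurable_kernelENN K).ennreal_toReal.aestronglyMeasurable.mul hf.comp_snd

theorem enorm_kernelENN_toReal_mul_le (x y : ℝ) :
    ‖(kernelENN K x y).toReal * f y‖ₑ ≤ kernelENN K x y * ‖f y‖ₑ := by
  rw [enorm_mul, Real.enorm_of_nonneg ENNReal.toReal_nonneg]
  gcongr
  exact ENNReal.ofReal_toReal_le

theorem lintegral_rpow_lt_top (hp₁ : 1 < p) (hp₂ : p < ∞) (hf : MemLp f p posVolume) :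
    ∫⁻ y, ‖f y‖ₑ ^ p.toReal ∂posVolume < ∞ :=
  lintegral_rpow_enorm_lt_top_of_eLpNorm_lt_top (zero_lt_one.trans hp₁).ne' hp₂.ne hf.2

theorem ae_lintegral_kernelENN_mul_lt_top (hK : IsDyadicMarkovKernel K) (hp₁ : 1 < p)
    (hp₂ : p < ∞) (hf : MemLp f p posVolume) :
    ∀ᵐ x ∂posVolume, ∫⁻ y, kernelENN K x y * ‖f y‖ₑ ∂posVolume < ∞ := by
  have hm := (aemeasurable_kernelENN_mul (K := K) hf.1 posVolume).lintegral_prod_right'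
  have h := ae_lt_top' (hm.pow_const p.toReal)
    ((lintegral_kernelENN_mul_rpow_le hK hp₁ hp₂ hf.1).trans_lt
      (lintegral_rpow_lt_top hp₁ hp₂ hf)).ne
  filter_upwards [h] with x hx
  exact (ENNReal.rpow_lt_top_iff_of_pos (by linarith [one_lt_toReal hp₁ hp₂])).1 hx

theorem kernelOp_eq (hK : IsDyadicMarkovKernel K) (f : ℝ → ℝ) {x : ℝ} (hx : 0 ≤ x) :
    kernelOp K f x = ∫ y, (kernelENN K x y).toReal * f y ∂posVolume :=
  integral_congr_ae (by
    filter_upwards [hK.ae_kernelENN hx] with y hy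
    rw [← hy.2])

theorem ae_integrable_kernel_mul (hK : IsDyadicMarkovKernel K) (hp₁ : 1 < p)
    (hp₂ : p < ∞) (hf : MemLp f p posVolume) :
    ∀ᵐ x ∂posVolume, Integrable (fun y => K x y * f y) posVolume := by
  filter_upwards [ae_lintegral_kernelENN_mul_lt_top hK hp₁ hp₂ hf, ae_posVolume_nonneg]
    with x hx hx0
  have hm : Measurable fun y => (kernelENN K x y).toReal :=
    ((measurable_kernelENN K).comp measurable_prodMk_left).ennreal_toReal
  have hi : Integrable (fun y => (kernelENN K x y).toReal * f y) posVolume :=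
    ⟨hm.aestronglyMeasurable.mul hf.1,
      (lintegral_mono fun y => enorm_kernelENN_toReal_mul_le x y).trans_lt hx⟩
  refine hi.congr ?_
  filter_upwards [hK.ae_kernelENN hx0] with y hy
  rw [← hy.2]

theorem memLp_kernelOp (hK : IsDyadicMarkovKernel K) (hp₁ : 1 < p) (hp₂ : p < ∞)
    (hf : MemLp f p posVolume) : MemLp (kernelOp K f) p posVolume := by
  have hae : (fun x => ∫ y, (kernelENN K x y).toReal * f y ∂posVolume) =ᵐ[posVolume]
      kernelOp K f := by
    filter_upwards [ae_posVolume_nonneg] with x hx using (kernelOp_eq hK f hx).symm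
  refine MemLp.ae_eq hae ⟨(aestronglyMeasurable_kernelENN_toReal_mul hf.1
    posVolume).integral_prod_right', ?_⟩
  refine (eLpNorm_lt_top_iff_lintegral_rpow_enorm_lt_top (zero_lt_one.trans hp₁).ne' hp₂.ne).2 ?_
  refine lt_of_le_of_lt ?_ (lintegral_rpow_lt_top hp₁ hp₂ hf)
  refine le_trans (lintegral_mono fun x => ?_) (lintegral_kernelENN_mul_rpow_le hK hp₁ hp₂ hf.1)
  refine ENNReal.rpow_le_rpow ?_ ENNReal.toReal_nonneg
  exact (enorm_integral_le_lintegral_enorm _).trans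
    (lintegral_mono fun y => enorm_kernelENN_toReal_mul_le x y)

/-- The integrand of `∫_I Tf` is integrable on the product. -/
theorem integrable_kernelENN_toReal_mul (hK : IsDyadicMarkovKernel K) (hp₁ : 1 < p) (hp₂ : p < ∞)
    (hf : MemLp f p posVolume) (j : ℤ) (k : ℕ) :
    Integrable (fun z : ℝ × ℝ => (kernelENN K z.1 z.2).toReal * f z.2)
      ((posVolume.restrict (dyadicInterval j k)).prod posVolume) := by
  refine ⟨aestronglyMeasurable_kernelENN_toReal_mul hf.1 _, ?_⟩
  have hdom : ∀ z : ℝ × ℝ, ‖(kernelENN K z.1 z.2).toReal * f z.2‖ₑ ≤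
      kernelENN K z.1 z.2 * ‖f z.2‖ₑ := fun z => enorm_kernelENN_toReal_mul_le z.1 z.2
  rw [hasFiniteIntegral_iff_enorm]
  refine lt_of_le_of_lt (lintegral_mono hdom) ?_
  rw [lintegral_prod _ (aemeasurable_kernelENN_mul hf.1 _)]
  have hp := one_lt_toReal hp₁ hp₂
  -- On an interval of finite measure this derives integrability from the `L^p` bound.
  have hle : ∀ t : ℝ≥0∞, t ≤ 1 + t ^ p.toReal := fun t => by
    rcases le_total t 1 with h | h
    · exact h.trans le_self_add
    · calc t = t ^ (1 : ℝ) := (ENNReal.rpow_one t).symm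
        _ ≤ t ^ p.toReal := ENNReal.rpow_le_rpow_of_exponent_le h hp.le
        _ ≤ _ := le_add_self
  refine (lintegral_mono fun x => hle _).trans_lt ?_
  rw [lintegral_add_left measurable_const, setLIntegral_const, posVolume_dyadicInterval]
  refine ENNReal.add_lt_top.2 ⟨by simp, ?_⟩
  exact (setLIntegral_le_lintegral _ _).trans_lt
    ((lintegral_kernelENN_mul_rpow_le hK hp₁ hp₂ hf.1).trans_lt (lintegral_rpow_lt_top hp₁ hp₂ hf))

theorem integral_kernelENN_toReal (hK : IsDyadicMarkovKernel K) (s : Set ℝ) (y : ℝ) :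
    ∫ x in s, (kernelENN K x y).toReal ∂posVolume =
      (∫⁻ x in s, kernelENN K x y ∂posVolume).toReal := by
  have hm : Measurable fun x => kernelENN K x y :=
    (measurable_kernelENN K).comp measurable_prodMk_right
  refine integral_toReal hm.aemeasurable (ae_lt_top hm ?_)
  exact ((setLIntegral_le_lintegral _ _).trans_lt
    ((lintegral_kernelENN_eq_one hK y).le.trans_lt ENNReal.one_lt_top)).ne

/-- Fubini moves the integral over the interval onto the kernel, so only the column masses computed
above enter. -/
theorem setIntegral_kernelOp (hK : IsDyadicMarkovKernel K) (hp₁ : 1 < p) (hp₂ : p < ∞)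
    (hf : MemLp f p posVolume) (j : ℤ) (k : ℕ) :
    Integrable (fun y => (∫⁻ x in dyadicInterval j k, kernelENN K x y ∂posVolume).toReal * f y)
      posVolume ∧
    ∫ x in dyadicInterval j k, kernelOp K f x ∂posVolume =
      ∫ y, (∫⁻ x in dyadicInterval j k, kernelENN K x y ∂posVolume).toReal * f y ∂posVolume := by
  have hi := integrable_kernelENN_toReal_mul hK hp₁ hp₂ hf j k
  have e : ∀ y, ∫ x in dyadicInterval j k, (kernelENN K x y).toReal * f y ∂posVolume =
      (∫⁻ x in dyadicInterval j k, kernelENN K x y ∂posVolume).toReal * f y := fun y => by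
    rw [integral_mul_const, integral_kernelENN_toReal hK]
  constructor
  · have := hi.integral_prod_right
    simpa only [e] using this
  · rw [setIntegral_congr_fun (measurableSet_dyadicInterval j k) fun x hx =>
      kernelOp_eq hK f (mem_dyadicInterval_iff.1 hx).1, integral_integral_swap hi]
    simp only [e]

/-- Haar coefficients of `Tf` are the eigenvalue multiples of those of `f`. -/
theorem halfDiff_kernelOp (hK : IsDyadicMarkovKernel K) (hp₁ : 1 < p) (hp₂ : p < ∞)
    (hf : MemLp f p posVolume) (j : ℤ) (k : ℕ) :
    halfDiff (kernelOp K f) j k = eigenvalue K j * halfDiff f j k := by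
  obtain ⟨i0, e0⟩ := setIntegral_kernelOp hK hp₁ hp₂ hf (j + 1) (2 * k)
  obtain ⟨i1, e1⟩ := setIntegral_kernelOp hK hp₁ hp₂ hf (j + 1) (2 * k + 1)
  have hloc := hf.dyadicIntegrable hp₁.le
  rw [halfDiff, halfDiff, e0, e1, ← integral_sub i0 i1]
  have hae : ∀ᵐ y ∂posVolume,
      (∫⁻ x in dyadicInterval (j + 1) (2 * k), kernelENN K x y ∂posVolume).toReal * f y -
        (∫⁻ x in dyadicInterval (j + 1) (2 * k + 1), kernelENN K x y ∂posVolume).toReal * f y =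
      eigenvalue K j * ((dyadicInterval (j + 1) (2 * k)).indicator f y -
        (dyadicInterval (j + 1) (2 * k + 1)).indicator f y) := by
    filter_upwards [ae_posVolume_nonneg] with y hy
    rw [← sub_mul, setLIntegral_kernelENN_sub hK hy, mul_assoc, sub_mul]
    congr 2 <;> simp [indicator]
  rw [integral_congr_ae hae, integral_const_mul,
    integral_sub ((hloc _ _).integrable_indicator (measurableSet_dyadicInterval _ _))
      ((hloc _ _).integrable_indicator (measurableSet_dyadicInterval _ _)),
    integral_indicator (measurableSet_dyadicInterval _ _),
    integral_indicator (measurableSet_dyadicInterval _ _)]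
  ring

/-! ### Haar coefficients and the square function of the statement. -/

theorem haar_eq (j : ℤ) (k : ℕ) (x : ℝ) : haar j k x = 2 ^ ((j : ℝ) / 2) *
    ((dyadicInterval (j + 1) (2 * k)).indicator 1 x -
      (dyadicInterval (j + 1) (2 * k + 1)).indicator 1 x) := by
  have h2 : (0 : ℝ) < 2 ^ j := by positivity
  have e : ∀ c : ℝ, c * 2 ^ (-(j + 1)) = c / 2 / 2 ^ j := fun c => by
    rw [neg_add, zpow_add₀ (by norm_num), zpow_neg, zpow_neg_one]
    field_simp
  have hL : x ∈ dyadicInterval (j + 1) (2 * k) ↔ 2 ^ j * x - k ∈ Ico (0 : ℝ) (1 / 2) := by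
    rw [dyadicInterval, mem_Ico, mem_Ico, e, e, div_le_iff₀ h2, lt_div_iff₀ h2]
    push_cast
    constructor <;> rintro ⟨h3, h4⟩ <;> constructor <;> linarith
  have hR : x ∈ dyadicInterval (j + 1) (2 * k + 1) ↔ 2 ^ j * x - k ∈ Ico (1 / 2 : ℝ) 1 := by
    rw [dyadicInterval, mem_Ico, mem_Ico, e, e, div_le_iff₀ h2, lt_div_iff₀ h2]
    push_cast
    constructor <;> rintro ⟨h3, h4⟩ <;> constructor <;> linarith
  rw [haar, haarMother]
  simp only [indicator, hL, hR, Pi.one_apply]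

theorem haarCoeff_eq (hf : DyadicIntegrable f) (j : ℤ) (k : ℕ) :
    haarCoeff f j k = 2 ^ ((j : ℝ) / 2) * (2 ^ (-j) * halfDiff f j k) := by
  have e : ∀ x, f x * haar j k x = 2 ^ ((j : ℝ) / 2) *
      ((dyadicInterval (j + 1) (2 * k)).indicator f x -
        (dyadicInterval (j + 1) (2 * k + 1)).indicator f x) := fun x => by
    rw [haar_eq, mul_left_comm, mul_sub]
    congr 2 <;> simp [indicator]
  rw [haarCoeff, halfDiff]
  simp only [e]
  rw [integral_const_mul,
    integral_sub ((hf _ _).integrable_indicator (measurableSet_dyadicInterval _ _))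
      ((hf _ _).integrable_indicator (measurableSet_dyadicInterval _ _)),
    integral_indicator (measurableSet_dyadicInterval _ _),
    integral_indicator (measurableSet_dyadicInterval _ _), ← mul_assoc (2 ^ (-j) : ℝ),
    ← zpow_add₀ (by norm_num)]
  simp

/-- The normalisations cancel: the coefficient is `2^{-j/2}` times `halfDiff`, and `|I|⁻¹ = 2^j`. -/
theorem haarCoeff_sq (hf : DyadicIntegrable f) (j : ℤ) (k : ℕ) :
    |haarCoeff f j k| ^ 2 * (volume.real (dyadicInterval j k))⁻¹ = halfDiff f j k ^ 2 := by
  have h1 : ((2 : ℝ) ^ ((j : ℝ) / 2)) ^ 2 = 2 ^ j := by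
    rw [← Real.rpow_mul_natCast (by norm_num), ← Real.rpow_intCast]
    congr 1
    push_cast; ring
  rw [sq_abs, haarCoeff_eq hf, volume_real_dyadicInterval, mul_pow, h1, mul_pow, zpow_neg]
  field_simp

/-- The Haar square function of `f` is the dyadic square function of `Tf`. -/
theorem haarSquareFunction_eq (hK : IsDyadicMarkovKernel K) (hp₁ : 1 < p) (hp₂ : p < ∞)
    (hf : MemLp f p posVolume) {x : ℝ} (hx : 0 ≤ x) :
    haarSquareFunction K f x = dyadicSquare (kernelOp K f) x := by
  have hloc := hf.dyadicIntegrable hp₁.le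
  have hlocT := (memLp_kernelOp hK hp₁ hp₂ hf).dyadicIntegrable hp₁.le
  rw [haarSquareFunction, dyadicSquare]
  congr 1
  rw [ENNReal.tsum_prod']
  refine tsum_congr fun j => ?_
  -- At each level exactly one interval contains `x`.
  rw [tsum_eq_single (dyadicIndex j x)]
  · simp only
    rw [indicator_of_mem (mem_dyadicInterval_dyadicIndex j hx), Pi.one_apply, mul_one, mul_assoc,
      haarCoeff_sq hloc, ← mul_pow, ← halfDiff_kernelOp hK hp₁ hp₂ hf, ← sq_abs,
      ← abs_dyadicDiff hlocT, sq_abs]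
  · intro k hk
    have : x ∉ dyadicInterval j k := fun h => hk (mem_dyadicInterval_iff.1 h).2.symm
    simp [indicator_of_notMem this]

theorem eLpNorm_haarSquareFunction (hK : IsDyadicMarkovKernel K) (hp₁ : 1 < p) (hp₂ : p < ∞)
    (hf : MemLp f p posVolume) :
    eLpNorm (haarSquareFunction K f) p posVolume =
      eLpNorm (dyadicSquare (kernelOp K f)) p posVolume := by
  rw [eLpNorm_dyadicSquare_eq hp₁ hp₂,
    eLpNorm_eq_lintegral_rpow_enorm_toReal (zero_lt_one.trans hp₁).ne' hp₂.ne]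
  congr 1
  refine lintegral_congr_ae ?_
  filter_upwards [ae_posVolume_nonneg] with x hx
  rw [enorm_eq_self, haarSquareFunction_eq hK hp₁ hp₂ hf hx]

end KernelOperator

end

end DyadicMarkov

/-! ### The main theorem. -/

theorem theorem4p4 (K : ℝ → ℝ → ℝ) (hK : DyadicMarkov.IsDyadicMarkovKernel K)
    (p : ℝ≥0∞) (hp₁ : 1 < p) (hp₂ : p < ∞) :
    (∀ f : ℝ → ℝ, MemLp f p DyadicMarkov.posVolume →
      (∀ᵐ x ∂DyadicMarkov.posVolume,
        Integrable (fun y => K x y * f y) DyadicMarkov.posVolume) ∧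
      MemLp (DyadicMarkov.kernelOp K f) p DyadicMarkov.posVolume) ∧
    ∃ C₁ C₂ : ℝ≥0, 0 < C₁ ∧ 0 < C₂ ∧
      ∀ f : ℝ → ℝ, MemLp f p DyadicMarkov.posVolume →
        C₁ * eLpNorm (DyadicMarkov.kernelOp K f) p DyadicMarkov.posVolume ≤
            eLpNorm (DyadicMarkov.haarSquareFunction K f) p DyadicMarkov.posVolume ∧
          eLpNorm (DyadicMarkov.haarSquareFunction K f) p DyadicMarkov.posVolume ≤
            C₂ * eLpNorm (DyadicMarkov.kernelOp K f) p DyadicMarkov.posVolume := by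
  refine ⟨fun f hf => ⟨DyadicMarkov.ae_integrable_kernel_mul hK hp₁ hp₂ hf,
    DyadicMarkov.memLp_kernelOp hK hp₁ hp₂ hf⟩, ?_⟩
  obtain ⟨A, hA⟩ := DyadicMarkov.exists_eLpNorm_le_dyadicSquare hp₁ hp₂
  obtain ⟨B, hB⟩ := DyadicMarkov.exists_eLpNorm_dyadicSquare_le hp₁ hp₂
  -- `A` and `B` are only nonnegative; adding `1` makes the constants strictly positive.
  refine ⟨(A + 1)⁻¹, B + 1, by positivity, by positivity, fun f hf => ?_⟩
  have hT := DyadicMarkov.memLp_kernelOp hK hp₁ hp₂ hf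
  rw [DyadicMarkov.eLpNorm_haarSquareFunction hK hp₁ hp₂ hf]
  constructor
  · rw [ENNReal.coe_inv (by positivity), ENNReal.inv_mul_le_iff (by simp) (by simp)]
    refine (hA _ hT).trans ?_
    gcongr
    exact le_self_add
  · refine (hB _ hT).trans ?_
    gcongr
    exact le_self_add
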